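/- Let $\mathcal S$ be a finite set of letters and $\mathcal N$ a countably infinite set of names, disjoint from $\mathcal S$. Languages are sets of finite words over $\mathcal S\cup\mathcal N$; such a language is *closed under permutations* if it is invariant under applying any bijection $\pi:\mathcal N\to\mathcal N$ to all the names of its words. **Expressions.** *up-NREs* are the expressions $$ne ::= 1 \mid 0 \mid n \mid \underline n \mid s \mid ne+ne \mid ne\circ ne \mid ne^\ast \mid \langle_n ne\rangle_n^m\qquad(n,m\in\mathcal N,\ s\in\mathcal S)$$ in which every subexpression $\langle_n ne'\rangle_n^m$ with $m\ne n$ lies in the scope of a binder $\langle_m\_\rangle_m^{m'}$. *p-NREs* are the up-NREs without underlined names. $\langle_n\_\rangle_n$ stands for $\langle_n\_\rangle_n^n$. An expression is *closed* if it has no free names. For pairwise distinct names $n_1,\dots,n_{h+1}$, the *first-degree* expressions are $$\mathsf{fne}::=1\mid 0\mid n_i\mid\underline{n_i}\mid s\mid\langle_{n_{h+1}}n_{h+1}\rangle_{n_{h+1}}^{n_i}\mid\mathsf{fne}+\mathsf{fne}\mid\mathsf{fne}\circ\mathsf{fne}\mid\mathsf{fne}^\ast\qquad(1\le i\le h),$$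 and an *$h$-prefixed first-degree* expression is one of the form $\langle_{n_1}\cdots\langle_{n_h}\mathsf{fne}\rangle_{n_h}\cdots\rangle_{n_1}$ with $h\ge 0$ and such an $\mathsf{fne}$ (which has no binders besides those shown in the grammar). **Languages of expressions.** A *chronicle* is a word of names and placeholders with a distinguished *current value*; $E@x$ appends $x$ to every chronicle of a list $E$ of chronicles, and $E@F$ concatenates two such lists chronicle by chronicle, with the current values of $F$. For a list $C=[n_1,\dots,n_k]$ of distinct names, $\mathbb C(C)$ is the list of the chronicles $n_i\cdots n_k$ with current values $n_i$. An expression $ne$ with a pre-context $C$ and a post-context $E$ (a list of $|C|$ chronicles) yields schematic words (a word over letters, names and placeholders, a list of freshness conditions, and a new post-context) as follows, where every placeholder that is introduced is completely new. - $1$, $s$, $n$ yield $\epsilon$, $s$, $n$ without conditions and with post-context $E$; $0$ yields nothing. - $\underline n$, with $n$ the $i$-th entry of $C$, yields a placeholder $x$ that is locally fresh for $C$ and fresh for the part $n_i\cdots n_k$ of the $i$-th chronicle; the post-context is $E@x$ with $x$ replacing $n$ as a current value. - $ne_1+ne_2$ yields what $ne_1$ or $ne_2$ yields, and $ne^\ast$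 what the $j$-fold compositions $ne\circ\cdots\circ ne$, $j\ge0$, yield. - $ne_1\circ ne_2$: let $w_1,\phi_1,E_1$ be yielded by $ne_1$ with contexts $C,\mathbb C(C)$, and $w_2,\phi_2,E_2$ by $ne_2$ with contexts $C,E$. Let $\pi$ send the entries of $C$ to the current values of $E_1$. The result is the word $w_1\,\pi(w_2)$ with conditions $\phi_1,\pi(\phi_2)$, where to each condition of $\phi_2$ on the $i$-th chronicle the $i$-th chronicle of $E_1$ is added, and post-context $E_1@\pi(E_2)$. - $\langle_n ne\rangle_n^m$: choose a name $a\notin C$ and take what $(n\,a)\cdot ne$ yields with pre-context $C+[a]$ and post-context $(E@a)+[t]$, where $t$ has current value $a$, and $t$ is the word $a$ if $m=n$, while if $m\ne n$, $t$ is the word $am$ and the current values $a$ and $m$ are exchanged. Drop the last chronicle from the resulting post-context, replace $a$ by a new placeholder $x$ everywhere, and add the condition that $x$ is locally fresh for $C$. For a closed $ne$, $\mathbf L(ne)$ is the set of all words obtained from the schematic words that $ne$ yields with empty contexts by assigning to the placeholders names that satisfy the conditions ("$x$ is fresh for $X$" meaning that $x$ is different from every element of $X$). **Automata.** A *fresh-register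 automaton* (FRA) with $r$ registers has a finite set of states, an initial state, a set of final states, an initial register assignment $\sigma_0$ (a partial map from $\{1,\dots,r\}$ to $\mathcal N$, injective where defined), and transitions labelled by a letter $s$ or by $i$, $i^\bullet$, $i^\circledast$ for a register $i$. Its configurations consist of a state, a register assignment $\sigma$ and a finite history $H\subseteq\mathcal N$; initially $\sigma=\sigma_0$ and $H$ is the image of $\sigma_0$. A transition labelled $s$ reads $s$; $i$ reads the name $\sigma(i)$ (which must be defined); $i^\bullet$ reads a name not in the image of $\sigma$, and $i^\circledast$ reads a name not in $H$; in the last two cases the name is stored in register $i$ and added to $H$. A word is accepted if it can be read ending in a final state. A *register automaton* (RA) is an FRA without transitions $i^\circledast$. **Theorem.** Let $A$ be an FRA whose accepted language is closed under permutations (for example, one whose registers are initially empty). Then for some $h\ge0$ there is a closed up-NRE $ne$ that is $h$-prefixed first-degree and has $\mathbf L(ne)$ equal to the language accepted by $A$. If moreover $A$ is an RA, then for some $h\ge0$ there is a closed p-NRE that is $h$-prefixed first-degree and whose language is the one accepted by $A$. -/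

import Mathlib

/-! ## Nominal regular expressions with underlines and permutations -/

/-- Raw syntax of up-NREs over the letters `S` and the names `N`. -/
inductive NRE (S N : Type*) where
  /-- the constant `1` (the empty word) -/
  | one : NRE S N
  /-- the constant `0` (the empty language) -/
  | zero : NRE S N
  /-- a name `n` -/
  | name (n : N) : NRE S N
  /-- an underlined name (relative global freshness) -/
  | cof (n : N) : NRE S N
  /-- a letter `s` -/
  | letter (s : S) : NRE S N
  /-- `e₁ + e₂` -/
  | plus (e₁ e₂ : NRE S N) : NRE S N
  /-- `e₁ ∘ e₂` -/
  | comp (e₁ e₂ : NRE S N) : NRE S N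
  /-- Kleene star -/
  | star (e : NRE S N) : NRE S N
  /-- `bind n e m` is the binder `⟨e⟩` with subscript `n` and superscript `m`: the name `n` is
  bound in `e`, and on leaving the scope `m` is deallocated and replaced by `n`.
  The plain binder is `bind n e n`. -/
  | bind (n : N) (e : NRE S N) (m : N) : NRE S N

namespace NRE

variable {S N : Type*}

/-- The action of a permutation of the names on expressions. -/
def perm (π : Equiv.Perm N) : NRE S N → NRE S N
  | one => one
  | zero => zero
  | name n => name (π n)
  | cof n => cof (π n)
  | letter s => letter s
  | plus e₁ e₂ => plus (perm π e₁) (perm π e₂)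
  | comp e₁ e₂ => comp (perm π e₁) (perm π e₂)
  | star e => star (perm π e)
  | bind n e m => bind (π n) (perm π e) (π m)

/-- `ScopedIn B e`: all the free names of `e` belong to `B`, and every binder of `e` whose
superscript `m` differs from its subscript lies in the scope of a binder for `m` in `e`,
unless `m` belongs to `B`. -/
def ScopedIn (B : Set N) : NRE S N → Prop
  | one => True
  | zero => True
  | name n => n ∈ B
  | cof n => n ∈ B
  | letter _ => True
  | plus e₁ e₂ => ScopedIn B e₁ ∧ ScopedIn B e₂
  | comp e₁ e₂ => ScopedIn B e₁ ∧ ScopedIn B e₂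
  | star e => ScopedIn B e
  | bind n e m => (m = n ∨ m ∈ B) ∧ ScopedIn (insert n B) e

/-- `e` is an up-NRE with no free names: it satisfies the scoping condition on superscripts, and
all its names are bound. -/
def IsClosedUpNRE (e : NRE S N) : Prop := ScopedIn ∅ e

/-- `e` contains no underlined name. -/
def UnderlineFree : NRE S N → Prop
  | one => True
  | zero => True
  | name _ => True
  | cof _ => False
  | letter _ => True
  | plus e₁ e₂ => UnderlineFree e₁ ∧ UnderlineFree e₂
  | comp e₁ e₂ => UnderlineFree e₁ ∧ UnderlineFree e₂
  | star e => UnderlineFree e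
  | bind _ e _ => UnderlineFree e

/-- `e` is a p-NRE with no free names. -/
def IsClosedPNRE (e : NRE S N) : Prop := IsClosedUpNRE e ∧ UnderlineFree e

/-- The grammar of first-degree expressions over the names `ns = [n₁, …, nₕ]` and the further name
`k = nₕ₊₁`; the only binders in it are those with subscript `k`, body `k` and superscript `nᵢ`. -/
inductive FirstDegree (ns : List N) (k : N) : NRE S N → Prop
  | one : FirstDegree ns k one
  | zero : FirstDegree ns k zero
  | name {n : N} (hn : n ∈ ns) : FirstDegree ns k (name n)
  | cof {n : N} (hn : n ∈ ns) : FirstDegree ns k (cof n)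
  | letter (s : S) : FirstDegree ns k (letter s)
  | fresh {n : N} (hn : n ∈ ns) : FirstDegree ns k (bind k (NRE.name k) n)
  | plus {e₁ e₂ : NRE S N} : FirstDegree ns k e₁ → FirstDegree ns k e₂ →
      FirstDegree ns k (plus e₁ e₂)
  | comp {e₁ e₂ : NRE S N} : FirstDegree ns k e₁ → FirstDegree ns k e₂ →
      FirstDegree ns k (comp e₁ e₂)
  | star {e : NRE S N} : FirstDegree ns k e → FirstDegree ns k (star e)

/-- `e` has the form `⟨n₁ ⋯ ⟨nₕ fne⟩ ⋯ ⟩` with plain binders, where `fne` is a first-degree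
expression over pairwise distinct names `n₁, …, nₕ, nₕ₊₁`. -/
def IsPrefixedFirstDegree (h : ℕ) (e : NRE S N) : Prop :=
  ∃ (ns : List N) (k : N) (fne : NRE S N),
    ns.length = h ∧ (ns ++ [k]).Nodup ∧ FirstDegree ns k fne ∧
      e = ns.foldr (fun n e' => bind n e' n) fne

/-- The `h`-fold composition `e ∘ ⋯ ∘ e`; it is `1` for `h = 0`. -/
def pow (e : NRE S N) : ℕ → NRE S N
  | 0 => one
  | 1 => e
  | h + 2 => comp e (pow e (h + 1))

end NRE

/-! ## Schematic words and chronicles -/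

/-- Names and placeholders. -/
inductive Atom (N : Type*) where
  | name (n : N) : Atom N
  | hole (i : ℕ) : Atom N
  deriving DecidableEq

/-- A chronicle: a word together with its current value. -/
structure Chronicle (N : Type*) where
  word : List (Atom N)
  cv : Atom N

/-- An extant chronicle: one chronicle for each register. -/
abbrev Extant (N : Type*) := List (Chronicle N)

/-- Freshness conditions: `loc x X` says that `x` is locally fresh for `X`, and `glob i x X` that
`x` is fresh for the part `X` of the chronicle of the `i`-th register (counted from `0`). -/
inductive Cond (N : Type*) where
  | loc (x : Atom N) (X : List (Atom N)) : Cond N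
  | glob (i : ℕ) (x : Atom N) (X : List (Atom N)) : Cond N

section calculus

variable {S N : Type*}

/-- Renaming in a chronicle. -/
def Chronicle.ren (f : Atom N → Atom N) (s : Chronicle N) : Chronicle N :=
  ⟨s.word.map f, f s.cv⟩

/-- Renaming in an extant chronicle. -/
def Extant.ren (f : Atom N → Atom N) (E : Extant N) : Extant N := E.map (Chronicle.ren f)

/-- Renaming of the current values only. -/
def Extant.renCv (f : Atom N → Atom N) (E : Extant N) : Extant N :=
  E.map fun s => ⟨s.word, f s.cv⟩

/-- `E @ x`: every chronicle is extended by the name or placeholder `x`. -/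
def Extant.snoc (E : Extant N) (x : Atom N) : Extant N :=
  E.map fun s => ⟨s.word ++ [x], s.cv⟩

/-- `E @ F`, element by element, with the current values of `F`. -/
def Extant.extend (E F : Extant N) : Extant N :=
  List.zipWith (fun s t => ⟨s.word ++ t.word, t.cv⟩) E F

/-- The natural extant chronicle of `C = [n₁, …, nₖ]`: the `i`-th chronicle is `nᵢ ⋯ nₖ`, with
current value `nᵢ`. -/
def natExtant : List N → Extant N
  | [] => []
  | n :: C => ⟨(n :: C).map Atom.name, Atom.name n⟩ :: natExtant C

/-- Renaming in a freshness condition. -/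
def Cond.ren (f : Atom N → Atom N) : Cond N → Cond N
  | .loc x X => .loc (f x) (X.map f)
  | .glob i x X => .glob i (f x) (X.map f)

/-- Update of a condition when something with post-context `E` is put in front: the condition is
renamed, and the condition on the `i`-th chronicle moreover gets the `i`-th chronicle of `E`.
(Conditions on registers that are deallocated already, that is, those beyond the length of `E`,
are only renamed.) -/
def Cond.update (f : Atom N → Atom N) (E : Extant N) : Cond N → Cond N
  | .loc x X => .loc (f x) (X.map f)
  | .glob i x X => .glob i (f x) (((E[i]?).map Chronicle.word).getD [] ++ X.map f)

/-- Renaming in a schematic word. -/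
def renWord (f : Atom N → Atom N) (w : List (S ⊕ Atom N)) : List (S ⊕ Atom N) :=
  w.map (Sum.map id f)

variable [DecidableEq N]

/-- The transposition of two names or placeholders. -/
def tr (x y : Atom N) : Atom N → Atom N := Equiv.swap x y

/-- The renaming that sends the `i`-th name of `C` to the `i`-th current value of `E`. All other
names and placeholders are fixed. (The completion to a permutation is immaterial: a current value
of `E` outside `C` is a placeholder used on the left of a composition, and such a placeholder
does not occur in what is renamed, the right of the composition.) -/
def ctxRen (C : List N) (E : Extant N) (x : Atom N) : Atom N :=
  (((C.map Atom.name).zip (E.map Chronicle.cv)).lookup x).getD x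

/-- `Derives C e E P w φ E'`: from the expression `e` with pre-context `C` and post-context `E`,
a derivation tree of the context calculus (read top-down), evaluated by the language calculus
(read bottom-up), yields the schematic word `w` with the conditions `φ` and post-context `E'`;
`P` is the set of the placeholders introduced in the tree. Each constructor is a rule of the
context calculus together with the rule of the language calculus that evaluates it. There is no
rule for `0`. Every placeholder that is introduced is new in the whole tree. -/
inductive Derives : List N → NRE S N → Extant N → Finset ℕ → List (S ⊕ Atom N) →
    List (Cond N) → Extant N → Prop
  | one (C : List N) (E : Extant N) : Derives C .one E ∅ [] [] E
  | letter (C : List N) (E : Extant N) (s : S) : Derives C (.letter s) E ∅ [.inl s] [] E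
  | name (C : List N) (E : Extant N) (n : N) :
      Derives C (.name n) E ∅ [.inr (.name n)] [] E
  | cof (C : List N) (E : Extant N) (n : N) (i p : ℕ) (s : Chronicle N)
      (hi : C[i]? = some n) (hs : (natExtant C)[i]? = some s) :
      Derives C (.cof n) E {p} [.inr (.hole p)]
        [.loc (.hole p) (C.map .name), .glob i (.hole p) s.word]
        ((E.snoc (.hole p)).renCv (tr (.name n) (.hole p)))
  | plus_left {C : List N} {e₁ e₂ : NRE S N} {E E' : Extant N} {P : Finset ℕ}
      {w : List (S ⊕ Atom N)} {φ : List (Cond N)} :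
      Derives C e₁ E P w φ E' → Derives C (.plus e₁ e₂) E P w φ E'
  | plus_right {C : List N} {e₁ e₂ : NRE S N} {E E' : Extant N} {P : Finset ℕ}
      {w : List (S ⊕ Atom N)} {φ : List (Cond N)} :
      Derives C e₂ E P w φ E' → Derives C (.plus e₁ e₂) E P w φ E'
  | comp {C : List N} {e₁ e₂ : NRE S N} {E E₁ E₂ : Extant N} {P₁ P₂ : Finset ℕ}
      {w₁ w₂ : List (S ⊕ Atom N)} {φ₁ φ₂ : List (Cond N)}
      (h₁ : Derives C e₁ (natExtant C) P₁ w₁ φ₁ E₁) (h₂ : Derives C e₂ E P₂ w₂ φ₂ E₂)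
      (hP : Disjoint P₁ P₂) :
      Derives C (.comp e₁ e₂) E (P₁ ∪ P₂) (w₁ ++ renWord (ctxRen C E₁) w₂)
        (φ₁ ++ φ₂.map (Cond.update (ctxRen C E₁) E₁))
        (E₁.extend (E₂.ren (ctxRen C E₁)))
  | star {C : List N} {e : NRE S N} {E E' : Extant N} {P : Finset ℕ}
      {w : List (S ⊕ Atom N)} {φ : List (Cond N)} (h : ℕ) :
      Derives C (e.pow h) E P w φ E' → Derives C (.star e) E P w φ E'
  | bind_eq {C : List N} {n a : N} {e : NRE S N} {E E' : Extant N} {t : Chronicle N}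
      {P : Finset ℕ} {w : List (S ⊕ Atom N)} {φ : List (Cond N)} (p : ℕ)
      (ha : a ∉ C) (hp : p ∉ P)
      (h : Derives (C ++ [a]) (e.perm (Equiv.swap n a))
        (E.snoc (.name a) ++ [⟨[.name a], .name a⟩]) P w φ (E' ++ [t])) :
      Derives C (.bind n e n) E (insert p P) (renWord (tr (.name a) (.hole p)) w)
        (.loc (.hole p) (C.map .name) :: φ.map (Cond.ren (tr (.name a) (.hole p))))
        (E'.ren (tr (.name a) (.hole p)))
  | bind_ne {C : List N} {n m a : N} {e : NRE S N} {E E' : Extant N} {t : Chronicle N}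
      {P : Finset ℕ} {w : List (S ⊕ Atom N)} {φ : List (Cond N)} (p : ℕ)
      (hm : m ≠ n) (ha : a ∉ C) (hp : p ∉ P)
      (h : Derives (C ++ [a]) (e.perm (Equiv.swap n a))
        (Extant.renCv (tr (.name m) (.name a))
          (E.snoc (.name a) ++ [⟨[.name a, .name m], .name a⟩])) P w φ (E' ++ [t])) :
      Derives C (.bind n e m) E (insert p P) (renWord (tr (.name a) (.hole p)) w)
        (.loc (.hole p) (C.map .name) :: φ.map (Cond.ren (tr (.name a) (.hole p))))
        (E'.ren (tr (.name a) (.hole p)))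

/-- The value of a name or placeholder under an assignment of names to the placeholders. -/
def Atom.val (ρ : ℕ → N) : Atom N → N
  | .name n => n
  | .hole i => ρ i

/-- The assignment `ρ` satisfies a freshness condition. -/
def Cond.Sat (ρ : ℕ → N) : Cond N → Prop
  | .loc x X => x.val ρ ∉ X.map (Atom.val ρ)
  | .glob _ x X => x.val ρ ∉ X.map (Atom.val ρ)

/-- The language of an NRE with no free names: all the words, over the letters and the names, that
are instances of one of its schematic words. -/
def NRE.lang (e : NRE S N) : Set (List (S ⊕ N)) :=
  {v | ∃ (P : Finset ℕ) (w : List (S ⊕ Atom N)) (φ : List (Cond N)) (E : Extant N) (ρ : ℕ → N),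
    Derives [] e [] P w φ E ∧ (∀ c ∈ φ, c.Sat ρ) ∧ v = w.map (Sum.map id (Atom.val ρ))}

end calculus

/-! ## Fresh-register automata -/

/-- Transition labels: a letter, reading the content of the register `i`, and reading a locally
(respectively globally) fresh name that is stored in the register `i`. -/
inductive FRALabel (S : Type*) (r : ℕ) where
  | letter (s : S) : FRALabel S r
  | known (i : Fin r) : FRALabel S r
  | locFresh (i : Fin r) : FRALabel S r
  | globFresh (i : Fin r) : FRALabel S r

/-- A fresh-register automaton over the letters `S` and the names `N`, with states `Q`. Distinct
registers never hold the same name; a register may be empty. -/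
structure FRA (S N Q : Type*) where
  /-- the number of registers -/
  regs : ℕ
  init : Q
  /-- the initial register assignment -/
  initReg : Fin regs → Option N
  initReg_inj : ∀ i j a, initReg i = some a → initReg j = some a → i = j
  trans : Q → FRALabel S regs → Q → Prop
  final : Set Q

namespace FRA

variable {S N Q : Type*}

/-- A register automaton is a fresh-register automaton without globally fresh transitions. -/
def IsRA (A : FRA S N Q) : Prop := ∀ q i q', ¬ A.trans q (.globFresh i) q'

/-- `A.Run q σ H v`: from the state `q`, the register assignment `σ` and the history `H` (the
names seen so far), the automaton can read the word `v` and stop in a final state. -/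
inductive Run (A : FRA S N Q) : Q → (Fin A.regs → Option N) → Set N → List (S ⊕ N) → Prop
  | nil {q : Q} {σ : Fin A.regs → Option N} {H : Set N} (hq : q ∈ A.final) : Run A q σ H []
  | letter {q q' : Q} {σ : Fin A.regs → Option N} {H : Set N} {s : S} {v : List (S ⊕ N)}
      (ht : A.trans q (.letter s) q') (hr : Run A q' σ H v) : Run A q σ H (.inl s :: v)
  | known {q q' : Q} {σ : Fin A.regs → Option N} {H : Set N} {i : Fin A.regs} {a : N}
      {v : List (S ⊕ N)} (ht : A.trans q (.known i) q') (ha : σ i = some a)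
      (hr : Run A q' σ H v) : Run A q σ H (.inr a :: v)
  | locFresh {q q' : Q} {σ : Fin A.regs → Option N} {H : Set N} {i : Fin A.regs} {a : N}
      {v : List (S ⊕ N)} (ht : A.trans q (.locFresh i) q') (ha : ∀ j, σ j ≠ some a)
      (hr : Run A q' (Function.update σ i (some a)) (insert a H) v) :
      Run A q σ H (.inr a :: v)
  | globFresh {q q' : Q} {σ : Fin A.regs → Option N} {H : Set N} {i : Fin A.regs} {a : N}
      {v : List (S ⊕ N)} (ht : A.trans q (.globFresh i) q') (ha : a ∉ H)
      (hr : Run A q' (Function.update σ i (some a)) (insert a H) v) :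
      Run A q σ H (.inr a :: v)

/-- The accepted language; the initial history consists of the names in the initial registers. -/
def lang (A : FRA S N Q) : Set (List (S ⊕ N)) :=
  {v | A.Run A.init A.initReg {a | ∃ i, A.initReg i = some a} v}

end FRA

/-- A language over `S` and `N` is closed under the action of the permutations of the names. -/
def PermClosed {S N : Type*} (L : Set (List (S ⊕ N))) : Prop :=
  ∀ (π : Equiv.Perm N), ∀ v ∈ L, v.map (Sum.map id π) ∈ L

/-! Without its data, the automaton is a finite automaton over the finite alphabet of transition
labels. Its states are paired with the set of registers written so far, and a register may be read
only once it is in that set. Kleene's theorem gives a regular expression `R` over labels. Replacing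
`known i` by the name `g i`, `globFresh i` by the underlined name, and `locFresh i` by a binder for
`k` with superscript `g i` turns `R` into a first-degree expression. One plain binder per register
is put in front of it.

The core is a compositional comparison of the calculus with `Exec`, which runs a label word on
registers that are all full. Current values play the role of register contents and chronicles that
of the history. Every freshly stored name is appended to every chronicle, so each single chronicle
records all names stored since the start. Both inclusions are inductions on `R`: `NRE.sound_toNRE`,
where each chronicle must cover the growth of the history, and `NRE.complete_toNRE`, where the
history must cover each chronicle. A valuation `θ` is given on all names and placeholders, so that
every renaming of the calculus becomes a precomposition of `θ`.

The outer binders supply arbitrary initial contents. These do not matter: unwritten registers are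
never read (`FRA.run_of_exec`), and for a given word they can be filled with distinct names that do
not occur in it (`FRA.exists_exec_of_run`). Likewise, permutation closure makes the automaton's own
initial contents irrelevant (`FRA.mem_lang_iff_run_empty`): the names of the word can be moved away
from them and back.

For a register automaton the same expression works. The letters of `R` are labels of actual
transitions, so no underlined name arises. -/

/-! ### Kleene's theorem: from labelled paths to regular expressions. -/

namespace RegularExpression

variable {α : Type*}

/-- All the letters of the regular expression belong to `T`. -/
def LettersIn (T : Set α) : RegularExpression α → Prop
  | zero => True
  | epsilon => True
  | char a => a ∈ T
  | plus P Q => LettersIn T P ∧ LettersIn T Q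
  | comp P Q => LettersIn T P ∧ LettersIn T Q
  | star P => LettersIn T P

/-- Finite unions of denotable languages are denotable. -/
theorem exists_matches'_eq_biUnion {ι : Type*} (T : Set α) (s : Finset ι) (L : ι → Language α)
    (h : ∀ i ∈ s, ∃ R : RegularExpression α, R.LettersIn T ∧ R.matches' = L i) :
    ∃ R : RegularExpression α, R.LettersIn T ∧ ∀ x, x ∈ R.matches' ↔ ∃ i ∈ s, x ∈ L i := by
  classical
  induction s using Finset.induction_on with
  | empty => exact ⟨zero, trivial, fun x => by simp [matches', Language.notMem_zero]⟩
  | insert i s hi ih =>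
    obtain ⟨R, hR, hL⟩ := ih fun j hj => h j (Finset.mem_insert_of_mem hj)
    obtain ⟨R', hR', hL'⟩ := h i (Finset.mem_insert_self i s)
    refine ⟨plus R' R, ⟨hR', hR⟩, fun x => ?_⟩
    simp [matches', Language.mem_add, hL, hL']

end RegularExpression

section Paths

variable {α V : Type*}

/-- The words labelling a path from `p` to `q` all of whose inner vertices belong to `T`. -/
inductive LabelledPath (step : V → α → V → Prop) (T : Set V) : V → List α → V → Prop
  | nil (p : V) : LabelledPath step T p [] p
  | single {p q : V} {a : α} (h : step p a q) : LabelledPath step T p [a] q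
  | cons {p t q : V} {a : α} {w : List α} (h : step p a t) (ht : t ∈ T)
      (hw : LabelledPath step T t w q) : LabelledPath step T p (a :: w) q

namespace LabelledPath

variable {step : V → α → V → Prop} {T U : Set V} {p q t : V} {v w : List α}

theorem mono (hTU : T ⊆ U) (h : LabelledPath step T p w q) : LabelledPath step U p w q := by
  induction h with
  | nil p => exact .nil p
  | single h => exact .single h
  | cons h ht _ ih => exact .cons h (hTU ht) ih

theorem append (ht : t ∈ T) (h₁ : LabelledPath step T p v t) (h₂ : LabelledPath step T t w q) :
    LabelledPath step T p (v ++ w) q := by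
  induction h₁ with
  | nil p => exact h₂
  | single h => exact .cons h ht h₂
  | cons h hu _ ih => exact .cons h hu (ih ht h₂)

/-- The language of the labels of paths with inner vertices in `T`. -/
def language (step : V → α → V → Prop) (T : Set V) (p q : V) : Language α :=
  {w | LabelledPath step T p w q}

/-- A path through `t` is cut at all its inner visits to `t`; the pieces between two consecutive
visits are loops at `t` that avoid `t` inside. -/
theorem language_insert (step : V → α → V → Prop) (T : Set V) (t p q : V) :
    language step (insert t T) p q = language step T p q +
      language step T p t * KStar.kstar (language step T t t) * language step T t q := by
  ext w
  rw [Language.mem_add, mul_assoc]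
  simp only [Language.mem_mul, Language.mem_kstar]
  constructor
  · intro h
    change LabelledPath _ _ _ _ _ at h
    induction h with
    | nil p => exact .inl (.nil p)
    | single h => exact .inl (.single h)
    | @cons p u q a w h hu hw ih =>
      rcases ih with ih | ⟨x, hx, y, ⟨z, ⟨Z, rfl, hZ⟩, b, hb, rfl⟩, rfl⟩
      · rcases hu with rfl | hu
        · exact .inr ⟨[a], .single h, w, ⟨[], ⟨[], by simp⟩, w, ih, by simp⟩, by simp⟩
        · exact .inl (.cons h hu ih)
      · right
        rcases hu with rfl | hu
        -- The first edge already ends in `t`, so the former initial piece `x` becomes the first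
        -- loop.
        · exact ⟨[a], .single h, _, ⟨_, ⟨x :: Z, rfl, by simpa using ⟨hx, hZ⟩⟩, b, hb, rfl⟩,
            by simp⟩
        · exact ⟨a :: x, .cons h hu hx, _, ⟨_, ⟨Z, rfl, hZ⟩, b, hb, rfl⟩, by simp⟩
  · have hT : T ⊆ insert t T := Set.subset_insert t T
    have ht : t ∈ insert t T := Set.mem_insert t T
    rintro (h | ⟨x, hx, y, ⟨z, ⟨Z, rfl, hZ⟩, b, hb, rfl⟩, rfl⟩)
    · exact mono hT h
    · refine append ht (mono hT hx) (append ht ?_ (mono hT hb))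
      clear hx hb
      induction Z with
      | nil => exact .nil t
      | cons z Z ih =>
        exact append ht (mono hT (hZ z (by simp))) (ih fun y hy => hZ y (by simp [hy]))

/-- The part of Kleene's theorem that turns automata into regular expressions. -/
theorem exists_matches'_eq_language [Finite α] (step : V → α → V → Prop) (T : Finset V) (p q : V) :
    ∃ R : RegularExpression α, R.LettersIn {a | ∃ p q, step p a q} ∧
      R.matches' = language step T p q := by
  classical
  induction T using Finset.induction_on generalizing p q with
  | empty =>
    have := Fintype.ofFinite α
    obtain ⟨R, hR, hL⟩ := RegularExpression.exists_matches'_eq_biUnion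
      {a | ∃ p q, step p a q} (Finset.univ.filter fun a => step p a q) (fun a => {[a]})
      fun a ha => ⟨.char a, ⟨p, q, (Finset.mem_filter.1 ha).2⟩, rfl⟩
    -- Without inner vertices a path has at most one edge.
    have key : ∀ w, w ∈ language step (∅ : Set V) p q ↔
        (p = q ∧ w = []) ∨ ∃ a, step p a q ∧ w = [a] := by
      intro w
      constructor
      · rintro (_ | h | ⟨h, hu, _⟩)
        · simp
        · exact .inr ⟨_, h, rfl⟩
        · exact hu.elim
      · rintro (⟨rfl, rfl⟩ | ⟨a, h, rfl⟩)
        · exact .nil p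
        · exact .single h
    have hL' : ∀ w, w ∈ R.matches' ↔ ∃ a, step p a q ∧ w = [a] := by
      intro w
      rw [hL]
      simp only [Finset.mem_filter, Finset.mem_univ, true_and]
      rfl
    by_cases hpq : p = q
    · refine ⟨.plus .epsilon R, ⟨trivial, hR⟩, ?_⟩
      ext w
      rw [Finset.coe_empty, key, RegularExpression.matches', Language.mem_add, hL',
        RegularExpression.matches', Language.mem_one]
      simp [hpq]
    · refine ⟨R, hR, ?_⟩
      ext w
      rw [Finset.coe_empty, key, hL']
      simp [hpq]
  | insert t T _ ih =>
    obtain ⟨R₁, h₁, e₁⟩ := ih p q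
    obtain ⟨R₂, h₂, e₂⟩ := ih p t
    obtain ⟨R₃, h₃, e₃⟩ := ih t t
    obtain ⟨R₄, h₄, e₄⟩ := ih t q
    refine ⟨.plus R₁ (.comp (.comp R₂ (.star R₃)) R₄), ⟨h₁, ⟨h₂, h₃⟩, h₄⟩, ?_⟩
    rw [Finset.coe_insert, language_insert]
    simp only [RegularExpression.matches', e₁, e₂, e₃, e₄]

end LabelledPath

end Paths

/-! ### Translation of regular expressions over labels into first-degree expressions. -/

section RegularTranslation

variable {S N : Type*} {r : ℕ}

/-- The first-degree expression of a regular expression over transition labels: the registers are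
named by `g`, and `k` is the auxiliary bound name. -/
def RegularExpression.toNRE (g : Fin r → N) (k : N) : RegularExpression (FRALabel S r) → NRE S N
  | zero => .zero
  | epsilon => .one
  | char (.letter s) => .letter s
  | char (.known i) => .name (g i)
  | char (.locFresh i) => .bind k (.name k) (g i)
  | char (.globFresh i) => .cof (g i)
  | plus P Q => .plus (P.toNRE g k) (Q.toNRE g k)
  | comp P Q => .comp (P.toNRE g k) (Q.toNRE g k)
  | star P => .star (P.toNRE g k)

namespace RegularExpression

/-- Opening a binder permutes the names of its body. The result is again a translation of the same
`R`, so statements quantified over `g` and `k` survive the opening of the prefix. -/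
theorem perm_toNRE (π : Equiv.Perm N) (g : Fin r → N) (k : N)
    (R : RegularExpression (FRALabel S r)) :
    (R.toNRE g k).perm π = R.toNRE (π ∘ g) (π k) := by
  induction R with
  | zero => rfl
  | epsilon => rfl
  | char a => cases a <;> rfl
  | plus P Q hP hQ => simp only [toNRE, NRE.perm, hP, hQ]
  | comp P Q hP hQ => simp only [toNRE, NRE.perm, hP, hQ]
  | star P hP => simp only [toNRE, NRE.perm, hP]

theorem firstDegree_toNRE (g : Fin r → N) (k : N) (R : RegularExpression (FRALabel S r)) :
    NRE.FirstDegree (List.ofFn g) k (R.toNRE g k) := by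
  have hg : ∀ i, g i ∈ List.ofFn g := fun i => (List.mem_ofFn' g _).2 ⟨i, rfl⟩
  induction R with
  | zero => exact .zero
  | epsilon => exact .one
  | char a =>
    cases a with
    | letter s => exact .letter s
    | known i => exact .name (hg i)
    | locFresh i => exact .fresh (hg i)
    | globFresh i => exact .cof (hg i)
  | plus P Q hP hQ => exact .plus hP hQ
  | comp P Q hP hQ => exact .comp hP hQ
  | star P hP => exact .star hP

theorem underlineFree_toNRE (g : Fin r → N) (k : N) {T : Set (FRALabel S r)}
    (hT : ∀ i, FRALabel.globFresh i ∉ T) :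
    ∀ R : RegularExpression (FRALabel S r), R.LettersIn T → (R.toNRE g k).UnderlineFree
  | zero, _ => trivial
  | epsilon, _ => trivial
  | char (.letter _), _ => trivial
  | char (.known _), _ => trivial
  | char (.locFresh _), _ => trivial
  | char (.globFresh i), h => hT i h
  | plus P Q, h => ⟨underlineFree_toNRE g k hT P h.1, underlineFree_toNRE g k hT Q h.2⟩
  | comp P Q, h => ⟨underlineFree_toNRE g k hT P h.1, underlineFree_toNRE g k hT Q h.2⟩
  | star P, h => underlineFree_toNRE g k hT P h

end RegularExpression

namespace NRE

/-- The expression `e` below plain binders for the names in `ns`. -/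
def bindAll (ns : List N) (e : NRE S N) : NRE S N := ns.foldr (fun n e' => bind n e' n) e

theorem perm_bindAll (π : Equiv.Perm N) (ns : List N) (e : NRE S N) :
    (bindAll ns e).perm π = bindAll (ns.map π) (e.perm π) := by
  induction ns with
  | nil => rfl
  | cons n ns ih => exact congrArg (fun e => bind (π n) e (π n)) ih

theorem perm_one (e : NRE S N) : e.perm 1 = e := by
  induction e <;> simp_all [perm]

theorem underlineFree_bindAll (ns : List N) {e : NRE S N} (h : e.UnderlineFree) :
    (bindAll ns e).UnderlineFree := by
  induction ns with
  | nil => exact h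
  | cons n ns ih => exact ih

theorem FirstDegree.scopedIn {ns : List N} {k : N} {e : NRE S N} (h : FirstDegree ns k e)
    {B : Set N} (hB : ∀ n ∈ ns, n ∈ B) : ScopedIn B e := by
  induction h with
  | one => trivial
  | zero => trivial
  | name hn => exact hB _ hn
  | cof hn => exact hB _ hn
  | letter s => trivial
  | fresh hn => exact ⟨.inr (hB _ hn), Set.mem_insert _ _⟩
  | plus _ _ h₁ h₂ => exact ⟨h₁, h₂⟩
  | comp _ _ h₁ h₂ => exact ⟨h₁, h₂⟩
  | star _ h => exact h

theorem scopedIn_bindAll (ns : List N) {e : NRE S N} {B : Set N}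
    (h : ScopedIn (B ∪ {n | n ∈ ns}) e) : ScopedIn B (bindAll ns e) := by
  induction ns generalizing B with
  | nil => simpa [bindAll] using h
  | cons n ns ih =>
    refine ⟨.inl rfl, ih ?_⟩
    convert h using 1
    ext x
    simp only [Set.mem_union, Set.mem_insert_iff, Set.mem_ofPred_eq, List.mem_cons]
    tauto

end NRE

/-! ## Executions of label words with full registers -/

/-- `Exec ℓ σ H v σ' H'`: reading the labels `ℓ` from the full registers `σ` and the history `H`
produces the word `v`, the registers `σ'` and the history `H'`. -/
inductive Exec : List (FRALabel S r) → (Fin r → N) → Set N → List (S ⊕ N) →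
    (Fin r → N) → Set N → Prop
  | nil (σ : Fin r → N) (H : Set N) : Exec [] σ H [] σ H
  | letter {ℓ : List (FRALabel S r)} {σ σ' : Fin r → N} {H H' : Set N} {v : List (S ⊕ N)} (s : S)
      (h : Exec ℓ σ H v σ' H') : Exec (.letter s :: ℓ) σ H (.inl s :: v) σ' H'
  | known {ℓ : List (FRALabel S r)} {σ σ' : Fin r → N} {H H' : Set N} {v : List (S ⊕ N)}
      (i : Fin r) (h : Exec ℓ σ H v σ' H') : Exec (.known i :: ℓ) σ H (.inr (σ i) :: v) σ' H'
  | locFresh {ℓ : List (FRALabel S r)} {σ σ' : Fin r → N} {H H' : Set N} {v : List (S ⊕ N)}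
      (i : Fin r) {a : N} (ha : ∀ j, σ j ≠ a)
      (h : Exec ℓ (Function.update σ i a) (insert a H) v σ' H') :
      Exec (.locFresh i :: ℓ) σ H (.inr a :: v) σ' H'
  | globFresh {ℓ : List (FRALabel S r)} {σ σ' : Fin r → N} {H H' : Set N} {v : List (S ⊕ N)}
      (i : Fin r) {a : N} (ha : ∀ j, σ j ≠ a) (haH : a ∉ H)
      (h : Exec ℓ (Function.update σ i a) (insert a H) v σ' H') :
      Exec (.globFresh i :: ℓ) σ H (.inr a :: v) σ' H'

namespace Exec

variable {ℓ ℓ₁ ℓ₂ : List (FRALabel S r)} {σ σ₁ σ₂ σ' : Fin r → N} {H H₁ H₂ H' : Set N}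
  {v v₁ v₂ : List (S ⊕ N)}

theorem append (h₁ : Exec ℓ₁ σ H v₁ σ₁ H₁) (h₂ : Exec ℓ₂ σ₁ H₁ v₂ σ₂ H₂) :
    Exec (ℓ₁ ++ ℓ₂) σ H (v₁ ++ v₂) σ₂ H₂ := by
  induction h₁ with
  | nil => exact h₂
  | letter s _ ih => exact .letter s (ih h₂)
  | known i _ ih => exact .known i (ih h₂)
  | locFresh i ha _ ih => exact .locFresh i ha (ih h₂)
  | globFresh i ha haH _ ih => exact .globFresh i ha haH (ih h₂)

theorem exists_of_append (h : Exec (ℓ₁ ++ ℓ₂) σ H v σ₂ H₂) :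
    ∃ v₁ v₂ σ₁ H₁, v = v₁ ++ v₂ ∧ Exec ℓ₁ σ H v₁ σ₁ H₁ ∧ Exec ℓ₂ σ₁ H₁ v₂ σ₂ H₂ := by
  induction ℓ₁ generalizing σ H v with
  | nil => exact ⟨[], v, σ, H, rfl, .nil σ H, h⟩
  | cons a ℓ₁ ih =>
    cases h with
    | letter s h =>
      obtain ⟨v₁, v₂, σ₁, H₁, rfl, e₁, e₂⟩ := ih h
      exact ⟨_, v₂, σ₁, H₁, rfl, .letter s e₁, e₂⟩
    | known i h =>
      obtain ⟨v₁, v₂, σ₁, H₁, rfl, e₁, e₂⟩ := ih h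
      exact ⟨_, v₂, σ₁, H₁, rfl, .known i e₁, e₂⟩
    | locFresh i ha h =>
      obtain ⟨v₁, v₂, σ₁, H₁, rfl, e₁, e₂⟩ := ih h
      exact ⟨_, v₂, σ₁, H₁, rfl, .locFresh i ha e₁, e₂⟩
    | globFresh i ha haH h =>
      obtain ⟨v₁, v₂, σ₁, H₁, rfl, e₁, e₂⟩ := ih h
      exact ⟨_, v₂, σ₁, H₁, rfl, .globFresh i ha haH e₁, e₂⟩

theorem history_mono (h : Exec ℓ σ H v σ' H') : H ⊆ H' := by
  induction h with
  | nil => exact subset_rfl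
  | letter _ _ ih => exact ih
  | known _ _ ih => exact ih
  | locFresh _ _ _ ih => exact (Set.subset_insert _ _).trans ih
  | globFresh _ _ _ _ ih => exact (Set.subset_insert _ _).trans ih

theorem range_subset (h : Exec ℓ σ H v σ' H') (hσ : Set.range σ ⊆ H) : Set.range σ' ⊆ H' := by
  have key : ∀ (σ : Fin r → N) (H : Set N) (i : Fin r) (a : N), Set.range σ ⊆ H →
      Set.range (Function.update σ i a) ⊆ insert a H := by
    rintro σ H i a hσ _ ⟨j, rfl⟩
    by_cases hj : j = i
    · subst hj; simp
    · rw [Function.update_of_ne hj]; exact .inr (hσ ⟨j, rfl⟩)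
  induction h with
  | nil => exact hσ
  | letter _ _ ih => exact ih hσ
  | known _ _ ih => exact ih hσ
  | locFresh _ _ _ ih => exact ih (key _ _ _ _ hσ)
  | globFresh _ _ _ _ ih => exact ih (key _ _ _ _ hσ)

end Exec

end RegularTranslation

/-! ### Evaluating conditions and chronicles under a valuation. -/

section Evaluation

variable {S N : Type*} {r : ℕ}

/-- Satisfaction of a freshness condition under a valuation `θ` of the names and placeholders, when
`K i` is the set of the names that the `i`-th chronicle contains beforehand. -/
def Cond.SatIn (K : ℕ → Set N) (θ : Atom N → N) : Cond N → Prop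
  | .loc x X => ∀ y ∈ X, θ x ≠ θ y
  | .glob i x X => θ x ∉ K i ∧ ∀ y ∈ X, θ x ≠ θ y

/-- The values of the entries of the `i`-th chronicle. -/
def Extant.hist (E : Extant N) (θ : Atom N → N) (i : ℕ) : Set N :=
  {a | ∃ s, E[i]? = some s ∧ ∃ y ∈ s.word, θ y = a}

/-- The current values of the chronicles are the contents of the registers `σ`. -/
def Extant.Holds (E : Extant N) (θ : Atom N → N) (σ : Fin r → N) : Prop :=
  ∀ i : Fin r, ∃ s, E[(i : ℕ)]? = some s ∧ θ s.cv = σ i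

theorem Cond.satIn_ren {K : ℕ → Set N} {θ : Atom N → N} {f : Atom N → Atom N} {c : Cond N} :
    (c.ren f).SatIn K θ ↔ c.SatIn K (θ ∘ f) := by
  cases c <;> simp [Cond.ren, Cond.SatIn]

theorem Cond.SatIn.anti {K K' : ℕ → Set N} {θ : Atom N → N} {c : Cond N} (hK : ∀ i, K i ⊆ K' i)
    (h : c.SatIn K' θ) : c.SatIn K θ := by
  cases c with
  | loc x X => exact h
  | glob i x X => exact ⟨fun hx => h.1 (hK i hx), h.2⟩

/-- The chronicle put in front of a condition can be counted as prior content. This lets the right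
factor of a composition be judged on its own, with the larger sets and the valuation `θ ∘ f`. If `E`
has no chronicle with the index in question, nothing is added on either side. -/
theorem Cond.satIn_update {K : ℕ → Set N} {θ : Atom N → N} {f : Atom N → Atom N} {E : Extant N}
    {c : Cond N} :
    (c.update f E).SatIn K θ ↔ c.SatIn (fun i => K i ∪ E.hist θ i) (θ ∘ f) := by
  cases c with
  | loc x X => simp [Cond.update, Cond.SatIn]
  | glob i x X =>
    cases hE : E[i]? with
    | none => simp [Cond.update, Cond.SatIn, hE, Extant.hist]
    | some s =>
      simp only [Cond.update, Cond.SatIn, hE, Extant.hist, Option.map_some, Option.getD_some,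
        List.mem_append, List.mem_map, Set.mem_union, Set.mem_ofPred_eq, Option.some.injEq,
        Function.comp_apply]
      constructor
      · rintro ⟨h₁, h₂⟩
        refine ⟨?_, fun y hy => h₂ _ (.inr ⟨y, hy, rfl⟩)⟩
        rintro (h | ⟨_, rfl, y, hy, h⟩)
        · exact h₁ h
        · exact h₂ y (.inl hy) h.symm
      · rintro ⟨h₁, h₂⟩
        refine ⟨fun h => h₁ (.inl h), ?_⟩
        rintro y (hy | ⟨y, hy, rfl⟩)
        · exact fun h => h₁ (.inr ⟨s, rfl, y, hy, h.symm⟩)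
        · exact h₂ y hy

theorem map_renWord (θ : Atom N → N) (f : Atom N → Atom N) (w : List (S ⊕ Atom N)) :
    (renWord f w).map (Sum.map id θ) = w.map (Sum.map id (θ ∘ f)) := by
  simp [renWord, Sum.map_comp_map]

theorem natExtant_append_singleton (C : List N) (a : N) :
    natExtant (C ++ [a]) = (natExtant C).snoc (.name a) ++ [⟨[.name a], .name a⟩] := by
  induction C with
  | nil => rfl
  | cons n C ih => simp [natExtant, ih, Extant.snoc]

theorem natExtant_getElem? (C : List N) (i : ℕ) :
    (natExtant C)[i]? = C[i]?.map fun n => ⟨(C.drop i).map .name, .name n⟩ := by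
  induction C generalizing i with
  | nil => rfl
  | cons n C ih =>
    cases i with
    | zero => rfl
    | succ i => simp [natExtant, ih]

theorem ofFn_getElem?_coe (g : Fin r → N) (i : Fin r) : (List.ofFn g)[(i : ℕ)]? = some (g i) := by
  simp

theorem natExtant_holds (g : Fin r → N) (θ : Atom N → N) :
    (natExtant (List.ofFn g)).Holds θ (fun i => θ (.name (g i))) := fun i =>
  ⟨_, by rw [natExtant_getElem?, ofFn_getElem?_coe]; rfl, rfl⟩

theorem natExtant_hist_subset (g : Fin r → N) (θ : Atom N → N) (i : ℕ) :
    (natExtant (List.ofFn g)).hist θ i ⊆ Set.range fun i => θ (.name (g i)) := by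
  rintro a ⟨s, hs, y, hy, rfl⟩
  rw [natExtant_getElem?, Option.map_eq_some_iff] at hs
  obtain ⟨n, -, rfl⟩ := hs
  obtain ⟨m, hm, rfl⟩ := List.mem_map.1 hy
  obtain ⟨j, rfl⟩ := (List.mem_ofFn' g m).1 (List.mem_of_mem_drop hm)
  exact ⟨j, rfl⟩

section Extend

variable {E₁ E₂ : Extant N} {θ : Atom N → N} {f : Atom N → Atom N} {σ₁ σ₂ : Fin r → N}

theorem Extant.getElem?_extend_ren {i : ℕ} {s t : Chronicle N} (h₁ : E₁[i]? = some s)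
    (h₂ : E₂[i]? = some t) :
    (E₁.extend (E₂.ren f))[i]? = some ⟨s.word ++ t.word.map f, f t.cv⟩ := by
  simp [Extant.extend, Extant.ren, List.getElem?_zipWith, h₁, h₂, Chronicle.ren]

theorem Extant.Holds.extend_ren (h₁ : E₁.Holds θ σ₁) (h₂ : E₂.Holds (θ ∘ f) σ₂) :
    (E₁.extend (E₂.ren f)).Holds θ σ₂ := fun i => by
  obtain ⟨s, hs, -⟩ := h₁ i
  obtain ⟨t, ht, hσ⟩ := h₂ i
  exact ⟨_, Extant.getElem?_extend_ren hs ht, hσ⟩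

theorem Extant.hist_extend_ren (h₁ : E₁.Holds θ σ₁) (h₂ : E₂.Holds (θ ∘ f) σ₂) (i : Fin r) :
    (E₁.extend (E₂.ren f)).hist θ i = E₁.hist θ i ∪ E₂.hist (θ ∘ f) i := by
  obtain ⟨s, hs, -⟩ := h₁ i
  obtain ⟨t, ht, -⟩ := h₂ i
  ext a
  simp only [Extant.hist, Extant.getElem?_extend_ren hs ht, hs, ht, Option.some.injEq,
    exists_eq_left', Set.mem_ofPred_eq, Set.mem_union, List.mem_append, List.mem_map,
    Function.comp_apply]
  constructor
  · rintro ⟨y, hy | ⟨y, hy, rfl⟩, rfl⟩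
    · exact .inl ⟨y, hy, rfl⟩
    · exact .inr ⟨y, hy, rfl⟩
  · rintro (⟨y, hy, rfl⟩ | ⟨y, hy, rfl⟩)
    · exact ⟨y, .inl hy, rfl⟩
    · exact ⟨_, .inr ⟨y, hy, rfl⟩, rfl⟩

end Extend

/-- `E` arises from the natural extant chronicle for `g` by storing the placeholder `p` in the
register `i`. -/
def Extant.Stores (g : Fin r → N) (i : Fin r) (p : ℕ) (E : Extant N) : Prop :=
  ∀ j : Fin r, E[(j : ℕ)]? = some ⟨((List.ofFn g).drop j).map .name ++ [.hole p],
    Function.update (fun j => Atom.name (g j)) i (.hole p) j⟩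

namespace Extant.Stores

variable {g : Fin r → N} {i : Fin r} {p : ℕ} {E : Extant N}

theorem holds (h : E.Stores g i p) (θ : Atom N → N) :
    E.Holds θ (Function.update (fun j => θ (.name (g j))) i (θ (.hole p))) := fun j => by
  refine ⟨_, h j, ?_⟩
  by_cases hj : j = i
  · subst hj; simp
  · simp [Function.update_of_ne hj]

theorem mem_hist (h : E.Stores g i p) (θ : Atom N → N) (j : Fin r) : θ (.hole p) ∈ E.hist θ j :=
  ⟨_, h j, .hole p, by simp, rfl⟩

theorem hist_subset (h : E.Stores g i p) (θ : Atom N → N) (j : Fin r) :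
    E.hist θ j ⊆ insert (θ (.hole p)) (Set.range fun j => θ (.name (g j))) := by
  rintro a ⟨s, hs, y, hy, rfl⟩
  rw [h j, Option.some.injEq] at hs
  subst hs
  rcases List.mem_append.1 hy with hy | hy
  · obtain ⟨m, hm, rfl⟩ := List.mem_map.1 hy
    obtain ⟨j, rfl⟩ := (List.mem_ofFn' g m).1 (List.mem_of_mem_drop hm)
    exact .inr ⟨j, rfl⟩
  · rw [List.mem_singleton.1 hy]
    exact .inl rfl

end Extant.Stores

variable [DecidableEq N]

theorem stores_of_cof {g : Fin r → N} (hg : g.Injective) (i : Fin r) (p : ℕ) :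
    (((natExtant (List.ofFn g)).snoc (.hole p)).renCv
      (tr (.name (g i)) (.hole p))).Stores g i p := fun j => by
  rw [Extant.renCv, Extant.snoc, List.map_map, List.getElem?_map, natExtant_getElem?,
    ofFn_getElem?_coe]
  by_cases hj : j = i
  · subst hj; simp [tr]
  · have : g j ≠ g i := fun h => hj (hg h)
    simp [tr, Function.update_of_ne hj, Equiv.swap_apply_def, this]

/-- The superscript exchanges the current values `g i` and `a`, and leaving the scope turns `a` into
the placeholder; as `a` is not among the `g j`, nothing else changes. The effect on the chronicles
is thus the same as for an underlined name. -/
theorem stores_of_bind {g : Fin r → N} (hg : g.Injective) (i : Fin r) (p : ℕ) {a : N}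
    (ha : a ∉ List.ofFn g) :
    (Extant.ren (tr (.name a) (.hole p)) (((natExtant (List.ofFn g)).snoc (.name a)).renCv
      (tr (.name (g i)) (.name a)))).Stores g i p := fun j => by
  have ha' : ∀ j, g j ≠ a := fun j h => ha ((List.mem_ofFn' g a).2 ⟨j, h⟩)
  rw [Extant.ren, Extant.renCv, Extant.snoc, List.map_map, List.map_map, List.getElem?_map,
    natExtant_getElem?, ofFn_getElem?_coe]
  have hw : ∀ n ∈ (List.ofFn g).drop j, tr (.name a) (.hole p) (Atom.name n) = .name n := by
    intro n hn
    have : n ≠ a := fun h => ha (h ▸ List.mem_of_mem_drop hn)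
    simp [tr, Equiv.swap_apply_def, this]
  have hw' : (((List.ofFn g).drop j).map Atom.name).map (tr (.name a) (.hole p)) =
      ((List.ofFn g).drop j).map Atom.name := by
    rw [List.map_map]
    exact List.map_congr_left hw
  simp only [Option.map_some, Function.comp_apply, Chronicle.ren, List.map_append, hw']
  by_cases hj : j = i
  · subst hj; simp [tr]
  · have : g j ≠ g i := fun h => hj (hg h)
    simp [tr, Function.update_of_ne hj, Equiv.swap_apply_def, this, ha']

/-- Only names occur as keys of the lookup. Hence the values of the placeholders are the same on
both sides of a composition. -/
theorem ctxRen_hole (C : List N) (E : Extant N) (p : ℕ) : ctxRen C E (.hole p) = .hole p := by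
  have : ((C.map Atom.name).zip (E.map Chronicle.cv)).lookup (.hole p) = none := by
    rw [List.lookup_eq_none_iff]
    rintro ⟨x, y⟩ hx
    obtain ⟨n, -, rfl⟩ := List.mem_map.1 (List.of_mem_zip hx).1
    simp
  rw [ctxRen, this, Option.getD_none]

theorem ctxRen_name {C : List N} (hC : C.Nodup) {E : Extant N} {i : ℕ} {n : N} {s : Chronicle N}
    (hn : C[i]? = some n) (hs : E[i]? = some s) : ctxRen C E (.name n) = s.cv := by
  suffices h : ((C.map Atom.name).zip (E.map Chronicle.cv)).lookup (.name n) = some s.cv by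
    rw [ctxRen, h, Option.getD_some]
  induction C generalizing E i with
  | nil => simp at hn
  | cons m C ih =>
    cases E with
    | nil => simp at hs
    | cons t E =>
      cases i with
      | zero =>
        simp only [List.getElem?_cons_zero, Option.some.injEq] at hn hs
        simp [hn, hs]
      | succ i =>
        simp only [List.getElem?_cons_succ] at hn hs
        have hne : n ≠ m := fun h =>
          (List.nodup_cons.1 hC).1 (h ▸ List.mem_of_getElem? hn)
        have := ih (List.nodup_cons.1 hC).2 hn hs
        have hb : (Atom.name n == Atom.name m) = false := by simpa using hne
        rw [List.map_cons, List.map_cons, List.zip_cons_cons, List.lookup_cons, hb]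
        exact this

/-- This is how registers are handed over in a composition: under the renamed valuation, the
register names denote the contents left by the left factor. -/
theorem comp_ctxRen_name {g : Fin r → N} (hg : g.Injective) {E : Extant N} {θ : Atom N → N}
    {σ : Fin r → N} (h : E.Holds θ σ) (i : Fin r) :
    (θ ∘ ctxRen (List.ofFn g) E) (.name (g i)) = σ i := by
  obtain ⟨s, hs, hσ⟩ := h i
  rw [Function.comp_apply, ctxRen_name (List.nodup_ofFn.2 hg) (ofFn_getElem?_coe g i) hs, hσ]

end Evaluation

/-! ## Inversion of derivations -/

section Inversion

variable {S N : Type*} [DecidableEq N] {C : List N} {E E' : Extant N} {P : Finset ℕ}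
  {w : List (S ⊕ Atom N)} {φ : List (Cond N)}

theorem Derives.name_inv {n : N} (h : Derives C (.name n) E P w φ E') :
    P = ∅ ∧ w = [.inr (.name n)] ∧ φ = [] ∧ E' = E := by
  cases h
  exact ⟨rfl, rfl, rfl, rfl⟩

theorem Derives.bind_eq_inv {n : N} {e : NRE S N} (h : Derives C (.bind n e n) E P w φ E') :
    ∃ (a : N) (p : ℕ) (P' : Finset ℕ) (w' : List (S ⊕ Atom N)) (φ' : List (Cond N))
      (E'' : Extant N), a ∉ C ∧
      Derives (C ++ [a]) (e.perm (Equiv.swap n a))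
        (E.snoc (.name a) ++ [⟨[.name a], .name a⟩]) P' w' φ' E'' ∧
      w = renWord (tr (.name a) (.hole p)) w' ∧
      φ = .loc (.hole p) (C.map .name) :: φ'.map (Cond.ren (tr (.name a) (.hole p))) := by
  cases h with
  | bind_eq p ha hp h => exact ⟨_, p, _, _, _, _, ha, h, rfl, rfl⟩
  | bind_ne p hm => exact absurd rfl hm

theorem Derives.bind_name_inv {n m : N} (hmn : m ≠ n)
    (h : Derives C (.bind n (.name n) m) E P w φ E') :
    ∃ (a : N) (p : ℕ), a ∉ C ∧ w = [.inr (.hole p)] ∧ φ = [.loc (.hole p) (C.map .name)] ∧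
      E' = Extant.ren (tr (.name a) (.hole p))
        ((E.snoc (.name a)).renCv (tr (.name m) (.name a))) := by
  cases h with
  | bind_eq => exact absurd rfl hmn
  | @bind_ne _ _ _ a _ _ _ _ _ _ _ p _ ha hp h =>
    obtain ⟨-, rfl, rfl, hE⟩ := h.name_inv
    refine ⟨a, p, ha, by simp [renWord, tr], rfl, ?_⟩
    rw [Extant.renCv, List.map_append, List.map_singleton] at hE
    rw [(List.append_inj' hE rfl).1]
    rfl

end Inversion

/-! ### Soundness and completeness of the translation below the prefix. -/

section Correctness

variable {S N : Type*} {r : ℕ}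

theorem natExtant_length (C : List N) : (natExtant C).length = C.length := by
  induction C with
  | nil => rfl
  | cons n C ih => simp [natExtant, ih]

/-- The natural extant chronicle describes registers that did not change. -/
theorem natExtant_holds_and_hist {g : Fin r → N} {σ : Fin r → N} {H : Set N} (hσ : Set.range σ ⊆ H)
    {θ : Atom N → N} (hθ : ∀ i, θ (.name (g i)) = σ i) :
    (natExtant (List.ofFn g)).Holds θ σ ∧
      ∀ i : Fin r, (natExtant (List.ofFn g)).hist θ i ⊆ H := by
  obtain rfl : (fun i => θ (.name (g i))) = σ := funext hθ
  exact ⟨natExtant_holds g θ, fun i => (natExtant_hist_subset g θ i).trans hσ⟩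

/-- A chronicle list with a stored placeholder describes updated registers. -/
theorem Extant.Stores.holds_and_hist {g : Fin r → N} {σ : Fin r → N} {H : Set N}
    (hσ : Set.range σ ⊆ H) {i : Fin r}
    {p : ℕ} {E : Extant N} (st : E.Stores g i p) {θ : Atom N → N} {a : N}
   
    (hθ : ∀ i, θ (.name (g i)) = σ i) (hp : θ (.hole p) = a) :
    E.Holds θ (Function.update σ i a) ∧ ∀ i : Fin r, E.hist θ i ⊆ insert a H := by
  obtain rfl : (fun i => θ (.name (g i))) = σ := funext hθ
  subst hp
  exact ⟨st.holds θ, fun j => (st.hist_subset θ j).trans (Set.insert_subset_insert hσ)⟩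

variable [DecidableEq N]

/-- Needed to split off the last chronicle when a binder is closed, and to see that no chronicle
exists beyond the registers. -/
theorem Derives.length_eq {C : List N} {e : NRE S N} {E E' : Extant N} {P : Finset ℕ}
    {w : List (S ⊕ Atom N)} {φ : List (Cond N)} (d : Derives C e E P w φ E')
    (hE : E.length = C.length) : E'.length = C.length := by
  induction d with
  | one => exact hE
  | letter => exact hE
  | name => exact hE
  | cof => simpa [Extant.renCv, Extant.snoc] using hE
  | plus_left _ ih => exact ih hE
  | plus_right _ ih => exact ih hE
  | comp _ _ _ ih₁ ih₂ => simp [Extant.extend, Extant.ren, ih₁ (natExtant_length _), ih₂ hE]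
  | star _ _ ih => exact ih hE
  | bind_eq p ha hp _ ih => simpa [Extant.ren, Extant.snoc, hE] using ih
  | bind_ne p hm ha hp _ ih => simpa [Extant.ren, Extant.renCv, Extant.snoc, hE] using ih

theorem Derives.hist_eq_empty {g : Fin r → N} {e : NRE S N} {E' : Extant N} {P : Finset ℕ}
    {w : List (S ⊕ Atom N)} {φ : List (Cond N)}
    (d : Derives (List.ofFn g) e (natExtant (List.ofFn g)) P w φ E') (θ : Atom N → N) {i : ℕ}
    (hi : r ≤ i) : E'.hist θ i = ∅ := by
  have hl := d.length_eq (natExtant_length _)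
  rw [List.length_ofFn] at hl
  simp [Extant.hist, List.getElem?_eq_none (hl.trans_le hi)]

/-- Every instance of a schematic word of `e` is produced by a word of labels in `L`. -/
def NRE.Sound (g : Fin r → N) (e : NRE S N) (L : Language (FRALabel S r)) : Prop :=
  ∀ (P : Finset ℕ) (w : List (S ⊕ Atom N)) (φ : List (Cond N)) (E' : Extant N),
    Derives (List.ofFn g) e (natExtant (List.ofFn g)) P w φ E' →
    ∀ (θ : Atom N → N) (H : Set N) (K : ℕ → Set N), (∀ i : Fin r, H ⊆ K i) → (∀ c ∈ φ, c.SatIn K θ) →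
      ∃ ℓ ∈ L, ∃ σ' H', Exec ℓ (fun i => θ (.name (g i))) H (w.map (Sum.map id θ)) σ' H' ∧
        E'.Holds θ σ' ∧ ∀ i : Fin r, H' ⊆ H ∪ E'.hist θ i

/-- Every word that is produced by labels in `L` is an instance of a schematic word of `e`. The
placeholders can be chosen outside any finite set. -/
def NRE.Complete (g : Fin r → N) (e : NRE S N) (L : Language (FRALabel S r)) : Prop :=
  ∀ ℓ ∈ L, ∀ (σ σ' : Fin r → N) (H H' : Set N) (v : List (S ⊕ N)), Exec ℓ σ H v σ' H' →
    Set.range σ ⊆ H → ∀ A : Finset ℕ,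
      ∃ (P : Finset ℕ) (w : List (S ⊕ Atom N)) (φ : List (Cond N)) (E' : Extant N) (ρ : ℕ → N),
        Disjoint A P ∧ Derives (List.ofFn g) e (natExtant (List.ofFn g)) P w φ E' ∧
        ∀ θ : Atom N → N, (∀ i, θ (.name (g i)) = σ i) → (∀ p ∈ P, θ (.hole p) = ρ p) →
          w.map (Sum.map id θ) = v ∧ (∀ c ∈ φ, c.SatIn (fun _ => H) θ) ∧ E'.Holds θ σ' ∧
            ∀ i : Fin r, E'.hist θ i ⊆ H'

namespace NRE

variable {g : Fin r → N} {e e₁ e₂ : NRE S N} {L L₁ L₂ : Language (FRALabel S r)}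

theorem Sound.mono (h : e.Sound g L₁) (hL : ∀ ℓ ∈ L₁, ℓ ∈ L₂) : e.Sound g L₂ := by
  intro P w φ E' d θ H K hK hφ
  obtain ⟨ℓ, hℓ, h⟩ := h P w φ E' d θ H K hK hφ
  exact ⟨ℓ, hL ℓ hℓ, h⟩

theorem Sound.zero (g : Fin r → N) : (zero : NRE S N).Sound g 0 := by
  intro P w φ E' h
  cases h

theorem Sound.one (g : Fin r → N) : (one : NRE S N).Sound g 1 := by
  intro P w φ E' h θ H K _ _
  cases h
  exact ⟨[], rfl, _, H, .nil _ H, natExtant_holds g θ, fun i => Set.subset_union_left⟩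

theorem Sound.letter (g : Fin r → N) (s : S) :
    (letter s : NRE S N).Sound g {[.letter s]} := by
  intro P w φ E' h θ H K _ _
  cases h
  exact ⟨_, rfl, _, H, .letter s (.nil _ H), natExtant_holds g θ,
    fun i => Set.subset_union_left⟩

theorem Sound.known (g : Fin r → N) (i : Fin r) :
    (name (g i) : NRE S N).Sound g {[.known i]} := by
  intro P w φ E' h θ H K _ _
  cases h
  exact ⟨_, rfl, _, H, .known i (.nil _ H), natExtant_holds g θ,
    fun i => Set.subset_union_left⟩

theorem Sound.locFresh (hg : g.Injective) {k : N} (hk : ∀ i, g i ≠ k) (i : Fin r) :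
    (bind k (name k) (g i) : NRE S N).Sound g {[.locFresh i]} := by
  intro P w φ E' h θ H K _ hφ
  obtain ⟨a, p, ha, rfl, rfl, rfl⟩ := h.bind_name_inv (hk i)
  have st := stores_of_bind hg i p ha
  have hp := hφ _ (List.mem_singleton_self _)
  refine ⟨_, rfl, _, _, .locFresh i (fun j => Ne.symm ?_) (.nil _ _), st.holds θ, fun j => ?_⟩
  · exact hp _ (List.mem_map_of_mem ((List.mem_ofFn' g _).2 ⟨j, rfl⟩))
  · rw [Set.insert_subset_iff]
    exact ⟨.inr (st.mem_hist θ j), Set.subset_union_left⟩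

theorem Sound.globFresh (hg : g.Injective) (i : Fin r) :
    (cof (g i) : NRE S N).Sound g {[.globFresh i]} := by
  intro P w φ E' h θ H K hK hφ
  cases h with
  | cof _ _ _ i' p s hi hs =>
    -- The rule looks up a position of the name in the context; distinct register names make it the
    -- register itself.
    have hi' : i' = i := by
      obtain ⟨hr, hgi⟩ := List.getElem?_eq_some_iff.1 hi
      rw [List.getElem_ofFn] at hgi
      exact congrArg Fin.val (hg hgi)
    subst hi'
    have st := stores_of_cof hg i p
    have h₁ := hφ _ (List.mem_cons_self ..)
    have h₂ := hφ _ (List.mem_cons_of_mem _ (List.mem_singleton_self _))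
    refine ⟨_, rfl, _, _, .globFresh i (fun j => Ne.symm ?_) (fun h => h₂.1 (hK _ h)) (.nil _ _),
      st.holds θ, fun j => ?_⟩
    · exact h₁ _ (List.mem_map_of_mem ((List.mem_ofFn' g _).2 ⟨j, rfl⟩))
    · rw [Set.insert_subset_iff]
      exact ⟨.inr (st.mem_hist θ j), Set.subset_union_left⟩

theorem Sound.plus (h₁ : e₁.Sound g L₁) (h₂ : e₂.Sound g L₂) :
    (plus e₁ e₂).Sound g (L₁ + L₂) := by
  intro P w φ E' h
  cases h with
  | plus_left h => exact h₁.mono (fun _ => .inl) _ _ _ _ h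
  | plus_right h => exact h₂.mono (fun _ => .inr) _ _ _ _ h

/-- The first chronicles cover what the left factor adds to the history. So `K i`, enlarged by the
`i`-th of them, contains the history from which the right factor starts, as its soundness requires.
-/
theorem Sound.comp (hg : g.Injective) (h₁ : e₁.Sound g L₁) (h₂ : e₂.Sound g L₂) :
    (comp e₁ e₂).Sound g (L₁ * L₂) := by
  intro P w φ E' h θ H K hK hφ
  cases h with
  | @comp _ _ _ _ E₁ E₂ P₁ P₂ w₁ w₂ φ₁ φ₂ d₁ d₂ hP =>
    obtain ⟨ℓ₁, hℓ₁, σ₁, H₁, x₁, r₁, k₁⟩ := h₁ _ _ _ _ d₁ θ H K hK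
      fun c hc => hφ c (List.mem_append_left _ hc)
    obtain ⟨ℓ₂, hℓ₂, σ₂, H₂, x₂, r₂, k₂⟩ := h₂ _ _ _ _ d₂ (θ ∘ ctxRen (List.ofFn g) E₁) H₁
      (fun i => K i ∪ E₁.hist θ i)
      (fun i => (k₁ i).trans (Set.union_subset_union_left _ (hK i)))
      fun c hc => Cond.satIn_update.1 (hφ _ (List.mem_append_right _ (List.mem_map_of_mem hc)))
    rw [funext (comp_ctxRen_name hg r₁)] at x₂
    refine ⟨ℓ₁ ++ ℓ₂, Language.append_mem_mul hℓ₁ hℓ₂, σ₂, H₂, ?_, r₁.extend_ren r₂, fun i => ?_⟩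
    · rw [List.map_append, map_renWord]
      exact x₁.append x₂
    · rw [Extant.hist_extend_ren r₁ r₂, ← Set.union_assoc]
      exact (k₂ i).trans (Set.union_subset_union_left _ (k₁ i))

theorem Sound.pow (hg : g.Injective) (h : e.Sound g L) (n : ℕ) : (e.pow n).Sound g (L ^ n) := by
  induction n with
  | zero => exact .one g
  | succ n ih =>
    -- `e.pow 1` is `e` itself, not a composition with `1`, so exponent one is a case of its own.
    cases n with
    | zero => rw [zero_add, pow_one]; exact h
    | succ n => rw [pow_succ']; exact h.comp hg ih

theorem Sound.star (hg : g.Injective) (h : e.Sound g L) : (star e).Sound g (KStar.kstar L) := by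
  intro P w φ E' d
  cases d with
  | star n d =>
    refine (h.pow hg n).mono (fun ℓ hℓ => ?_) _ _ _ _ d
    rw [Language.kstar_eq_iSup_pow]
    exact Language.mem_iSup.2 ⟨n, hℓ⟩

theorem sound_toNRE (hg : g.Injective) {k : N} (hk : ∀ i, g i ≠ k)
    (R : RegularExpression (FRALabel S r)) : (R.toNRE g k).Sound g R.matches' := by
  induction R with
  | zero => exact .zero g
  | epsilon => exact .one g
  | char a =>
    cases a with
    | letter s => exact .letter g s
    | known i => exact .known g i
    | locFresh i => exact .locFresh hg hk i
    | globFresh i => exact .globFresh hg i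
  | plus P Q hP hQ => exact hP.plus hQ
  | comp P Q hP hQ => exact hP.comp hg hQ
  | star P hP => exact hP.star hg

theorem Complete.zero (g : Fin r → N) : (zero : NRE S N).Complete g 0 := fun ℓ hℓ =>
  (Language.notMem_zero ℓ hℓ).elim

theorem Complete.one [Nonempty N] (g : Fin r → N) : (one : NRE S N).Complete g 1 := by
  rintro ℓ rfl σ σ' H H' v h hσ A
  cases h
  exact ⟨∅, [], [], _, fun _ => Classical.arbitrary N, Finset.disjoint_empty_right A, .one _ _,
    fun θ hθ _ => ⟨rfl, by simp, natExtant_holds_and_hist hσ hθ⟩⟩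

theorem Complete.letter [Nonempty N] (g : Fin r → N) (s : S) :
    (letter s : NRE S N).Complete g {[.letter s]} := by
  rintro ℓ rfl σ σ' H H' v h hσ A
  cases h with | letter _ h =>
  cases h
  exact ⟨∅, _, [], _, fun _ => Classical.arbitrary N, Finset.disjoint_empty_right A, .letter _ _ s,
    fun θ hθ _ => ⟨rfl, by simp, natExtant_holds_and_hist hσ hθ⟩⟩

theorem Complete.known [Nonempty N] (g : Fin r → N) (i : Fin r) :
    (name (g i) : NRE S N).Complete g {[.known i]} := by
  rintro ℓ rfl σ σ' H H' v h hσ A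
  cases h with | known _ h =>
  cases h
  exact ⟨∅, _, [], _, fun _ => Classical.arbitrary N, Finset.disjoint_empty_right A, .name _ _ _,
    fun θ hθ _ => ⟨by simp [hθ], by simp, natExtant_holds_and_hist hσ hθ⟩⟩

theorem Complete.locFresh [Infinite N] (hg : g.Injective) {k : N} (hk : ∀ i, g i ≠ k) (i : Fin r) :
    (bind k (name k) (g i) : NRE S N).Complete g {[.locFresh i]} := by
  rintro ℓ rfl σ σ' H H' v h hσ A
  cases h with | @locFresh _ _ _ _ _ _ _ a ha h =>
  cases h
  obtain ⟨p, hp⟩ := Infinite.exists_notMem_finset A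
  have hkC : k ∉ List.ofFn g := fun h => by
    obtain ⟨j, hj⟩ := (List.mem_ofFn' g k).1 h
    exact hk j hj
  -- Taking the bound name `k` itself as the chosen name makes the swap trivial.
  have d : Derives (S := S) (List.ofFn g) (bind k (name k) (g i)) (natExtant (List.ofFn g)) _ _ _ _ :=
    Derives.bind_ne (a := k) (E' := ((natExtant (List.ofFn g)).snoc (.name k)).renCv
        (tr (.name (g i)) (.name k))) (t := ⟨[.name k, .name (g i)], tr (.name (g i)) (.name k)
        (.name k)⟩) p (hk i) hkC (Finset.notMem_empty p) (by
      rw [Equiv.swap_self, perm]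
      rw [Extant.renCv, Extant.renCv, List.map_append, List.map_singleton]
      exact .name _ _ _)
  refine ⟨_, _, _, _, fun _ => a, ?_, d, fun θ hθ hρ => ?_⟩
  · simpa using hp
  · have hpa : θ (.hole p) = a := hρ p (by simp)
    refine ⟨by simp [renWord, tr, hpa], ?_,
      (stores_of_bind hg i p hkC).holds_and_hist hσ hθ hpa⟩
    intro c hc
    obtain rfl : c = .loc (.hole p) ((List.ofFn g).map .name) := List.mem_singleton.1 hc
    intro y hy
    obtain ⟨n, hn, rfl⟩ := List.mem_map.1 hy
    obtain ⟨j, rfl⟩ := (List.mem_ofFn' g n).1 hn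
    rw [hpa, hθ]
    exact (ha j).symm

theorem Complete.globFresh [Infinite N] (hg : g.Injective) (i : Fin r) :
    (cof (g i) : NRE S N).Complete g {[.globFresh i]} := by
  rintro ℓ rfl σ σ' H H' v h hσ A
  cases h with | @globFresh _ _ _ _ _ _ _ a ha haH h =>
  cases h
  obtain ⟨p, hp⟩ := Infinite.exists_notMem_finset A
  have hs : (natExtant (List.ofFn g))[(i : ℕ)]? =
      some ⟨((List.ofFn g).drop i).map .name, .name (g i)⟩ := by
    rw [natExtant_getElem?, ofFn_getElem?_coe]
    rfl
  refine ⟨_, _, _, _, fun _ => a, ?_,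
    Derives.cof _ _ _ i p _ (ofFn_getElem?_coe g i) hs, fun θ hθ hρ => ?_⟩
  · simpa using hp
  · have hpa : θ (.hole p) = a := hρ p (by simp)
    have hX : ∀ y ∈ (List.ofFn g).map Atom.name, θ (.hole p) ≠ θ y := by
      intro y hy
      obtain ⟨n, hn, rfl⟩ := List.mem_map.1 hy
      obtain ⟨j, rfl⟩ := (List.mem_ofFn' g n).1 hn
      rw [hpa, hθ]
      exact (ha j).symm
    refine ⟨by simp [hpa], ?_, (stores_of_cof hg i p).holds_and_hist hσ hθ hpa⟩
    intro c hc
    rw [List.mem_cons, List.mem_singleton] at hc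
    rcases hc with rfl | rfl
    · exact hX
    -- The initial part of the chronicle is a suffix of the context, so local freshness covers it.
    · refine ⟨hpa ▸ haH, fun y hy => hX y ?_⟩
      exact List.map_subset _ (List.drop_subset _ _) hy

theorem Complete.plus (h₁ : e₁.Complete g L₁) (h₂ : e₂.Complete g L₂) :
    (plus e₁ e₂).Complete g (L₁ + L₂) := by
  rintro ℓ (hℓ | hℓ) σ σ' H H' v h hσ A
  · obtain ⟨P, w, φ, E', ρ, hA, d, hd⟩ := h₁ ℓ hℓ σ σ' H H' v h hσ A
    exact ⟨P, w, φ, E', ρ, hA, .plus_left d, hd⟩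
  · obtain ⟨P, w, φ, E', ρ, hA, d, hd⟩ := h₂ ℓ hℓ σ σ' H H' v h hσ A
    exact ⟨P, w, φ, E', ρ, hA, .plus_right d, hd⟩

/-- The placeholders on the right are chosen outside `A ∪ P₁`. This makes the derivations composable
and lets the two assignments be glued along `P₁`. -/
theorem Complete.comp (hg : g.Injective) (h₁ : e₁.Complete g L₁) (h₂ : e₂.Complete g L₂) :
    (comp e₁ e₂).Complete g (L₁ * L₂) := by
  rintro _ ⟨ℓ₁, hℓ₁, ℓ₂, hℓ₂, rfl⟩ σ σ' H H' v h hσ A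
  obtain ⟨v₁, v₂, σ₁, H₁, rfl, x₁, x₂⟩ := h.exists_of_append
  obtain ⟨P₁, w₁, φ₁, E₁, ρ₁, hA₁, d₁, hd₁⟩ := h₁ ℓ₁ hℓ₁ σ σ₁ H H₁ v₁ x₁ hσ A
  obtain ⟨P₂, w₂, φ₂, E₂, ρ₂, hA₂, d₂, hd₂⟩ :=
    h₂ ℓ₂ hℓ₂ σ₁ σ' H₁ H' v₂ x₂ (x₁.range_subset hσ) (A ∪ P₁)
  rw [Finset.disjoint_union_left] at hA₂
  refine ⟨_, _, _, _, fun p => if p ∈ P₁ then ρ₁ p else ρ₂ p,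
    Finset.disjoint_union_right.2 ⟨hA₁, hA₂.1⟩, .comp d₁ d₂ hA₂.2, fun θ hθ hρ => ?_⟩
  obtain ⟨hw₁, hφ₁, hE₁, hH₁⟩ := hd₁ θ hθ fun p hp => by
    rw [hρ p (Finset.mem_union_left _ hp)]
    exact if_pos hp
  obtain ⟨hw₂, hφ₂, hE₂, hH₂⟩ := hd₂ (θ ∘ ctxRen (List.ofFn g) E₁) (comp_ctxRen_name hg hE₁)
    fun p hp => by
      rw [Function.comp_apply, ctxRen_hole, hρ p (Finset.mem_union_right _ hp)]
      exact if_neg (Finset.disjoint_right.1 hA₂.2 hp)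
  refine ⟨by rw [List.map_append, map_renWord, hw₁, hw₂], fun c hc => ?_,
    hE₁.extend_ren hE₂, fun i => ?_⟩
  · rcases List.mem_append.1 hc with hc | hc
    · exact hφ₁ c hc
    · obtain ⟨c', hc', rfl⟩ := List.mem_map.1 hc
      refine Cond.satIn_update.2 ((hφ₂ c' hc').anti fun i => Set.union_subset x₁.history_mono ?_)
      -- A condition carries an arbitrary natural index; beyond the registers there is no chronicle,
      -- hence no history.
      by_cases hi : i < r
      · exact hH₁ ⟨i, hi⟩
      · rw [d₁.hist_eq_empty θ (not_lt.1 hi)]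
        exact Set.empty_subset H₁
  · rw [Extant.hist_extend_ren hE₁ hE₂]
    exact Set.union_subset ((hH₁ i).trans x₂.history_mono) (hH₂ i)

theorem Complete.pow [Nonempty N] (hg : g.Injective) (h : e.Complete g L) (n : ℕ) :
    (e.pow n).Complete g (L ^ n) := by
  induction n with
  | zero => exact .one g
  | succ n ih =>
    cases n with
    | zero => rw [zero_add, pow_one]; exact h
    | succ n => rw [pow_succ']; exact h.comp hg ih

theorem Complete.star [Nonempty N] (hg : g.Injective) (h : e.Complete g L) :
    (star e).Complete g (KStar.kstar L) := by
  intro ℓ hℓ σ σ' H H' v x hσ A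
  rw [Language.kstar_eq_iSup_pow] at hℓ
  obtain ⟨n, hℓ⟩ := Language.mem_iSup.1 hℓ
  obtain ⟨P, w, φ, E', ρ, hA, d, hd⟩ := h.pow hg n ℓ hℓ σ σ' H H' v x hσ A
  exact ⟨P, w, φ, E', ρ, hA, .star n d, hd⟩

theorem complete_toNRE [Infinite N] (hg : g.Injective) {k : N} (hk : ∀ i, g i ≠ k)
    (R : RegularExpression (FRALabel S r)) : (R.toNRE g k).Complete g R.matches' := by
  induction R with
  | zero => exact .zero g
  | epsilon => exact .one g
  | char a =>
    cases a with
    | letter s => exact .letter g s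
    | known i => exact .known g i
    | locFresh i => exact .locFresh hg hk i
    | globFresh i => exact .globFresh hg i
  | plus P Q hP hQ => exact hP.plus hQ
  | comp P Q hP hQ => exact hP.comp hg hQ
  | star P hP => exact hP.star hg

end NRE

end Correctness

/-! ### Opening and closing the prefix of binders. -/

section Prefixed

variable {S N : Type*} {r : ℕ}

theorem Cond.sat_iff_satIn_empty (ρ : ℕ → N) (c : Cond N) :
    c.Sat ρ ↔ c.SatIn (fun _ => ∅) (Atom.val ρ) := by
  cases c <;> simp [Cond.Sat, Cond.SatIn, eq_comm]

variable [DecidableEq N]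

namespace NRE

/-- `C` holds the names of the binders already opened, `ns` those still closed. Each opening may
rename the remaining names, so the induction is on the length of `ns`, with `g` and `k` free to
change. At the end soundness applies with empty history. -/
theorem exists_exec_of_derives_bindAll (ns : List N) {C : List N} {g : Fin r → N} {k : N}
    (hg : g.Injective) (hk : ∀ i, g i ≠ k) (hC : List.ofFn g = C ++ ns)
    {R : RegularExpression (FRALabel S r)} {P : Finset ℕ} {w : List (S ⊕ Atom N)}
    {φ : List (Cond N)} {E' : Extant N}
    (d : Derives C (bindAll ns (R.toNRE g k)) (natExtant C) P w φ E') (θ : Atom N → N)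
    (hφ : ∀ c ∈ φ, c.SatIn (fun _ => ∅) θ) :
    ∃ ℓ ∈ R.matches', ∃ σ σ' H', Exec ℓ σ ∅ (w.map (Sum.map id θ)) σ' H' := by
  induction hl : ns.length generalizing ns C g k P w φ E' θ with
  | zero =>
    obtain rfl := List.length_eq_zero_iff.1 hl
    rw [List.append_nil] at hC
    subst hC
    obtain ⟨ℓ, hℓ, σ', H', x, -⟩ := sound_toNRE hg hk R P w φ E' d θ ∅ (fun _ => ∅)
      (fun _ => subset_rfl) hφ
    exact ⟨ℓ, hℓ, _, σ', H', x⟩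
  | succ m ih =>
    obtain ⟨n, ns, rfl⟩ := List.exists_cons_of_length_eq_add_one hl
    obtain ⟨a, p, P', w', φ', E'', ha, d', rfl, rfl⟩ := Derives.bind_eq_inv d
    rw [← natExtant_append_singleton] at d'
    change Derives (C ++ [a]) ((bindAll ns _).perm _) _ _ _ _ _ at d'
    rw [perm_bindAll, RegularExpression.perm_toNRE] at d'
    have hnd : (C ++ n :: ns).Nodup := hC ▸ List.nodup_ofFn.2 hg
    have hnC : n ∉ C := fun h => (List.nodup_append.1 hnd).2.2 n h n (List.mem_cons_self ..) rfl
    -- The swap fixes the opened names, since neither `n` nor `a` is among them; it may well move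
    -- later names or `k`.
    have hmap : C.map (Equiv.swap n a) = C := by
      conv_rhs => rw [← List.map_id C]
      refine List.map_congr_left fun m hm => Equiv.swap_apply_of_ne_of_ne ?_ ?_
      · exact fun h => hnC (h ▸ hm)
      · exact fun h => ha (h ▸ hm)
    obtain ⟨ℓ, hℓ, h⟩ := ih (ns.map (Equiv.swap n a)) ((Equiv.swap n a).injective.comp hg)
      (fun i h => hk i ((Equiv.swap n a).injective h))
      (by rw [← List.map_ofFn, hC, List.map_append, List.map_cons, hmap]; simp) d'
      (θ ∘ tr (.name a) (.hole p)) (fun c hc => Cond.satIn_ren.1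
        (hφ _ (List.mem_cons_of_mem _ (List.mem_map_of_mem hc))))
      (by simpa using hl)
    rw [map_renWord]
    exact ⟨ℓ, hℓ, h⟩

/-- Binders are closed from the inside out. Once closed, the binder of a register contributes a
placeholder whose assigned value is the initial content of that register. Thus `θ` is prescribed
only on the register names that are still open. -/
theorem derives_bindAll_of_exec [Infinite N] {g : Fin r → N} {k : N} (hg : g.Injective)
    (hk : ∀ i, g i ≠ k) {R : RegularExpression (FRALabel S r)} {ℓ : List (FRALabel S r)}
    (hℓ : ℓ ∈ R.matches') {σ σ' : Fin r → N} {H H' : Set N} {v : List (S ⊕ N)}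
    (hσ : σ.Injective) (hH : Set.range σ ⊆ H) (x : Exec ℓ σ H v σ' H') (ns C : List N)
    (hC : List.ofFn g = C ++ ns) :
    ∃ (P : Finset ℕ) (w : List (S ⊕ Atom N)) (φ : List (Cond N)) (E' : Extant N) (ρ : ℕ → N),
      Derives C (bindAll ns (R.toNRE g k)) (natExtant C) P w φ E' ∧
      ∀ θ : Atom N → N, (∀ i : Fin r, (i : ℕ) < C.length → θ (.name (g i)) = σ i) →
        (∀ p ∈ P, θ (.hole p) = ρ p) →
        w.map (Sum.map id θ) = v ∧ ∀ c ∈ φ, c.SatIn (fun _ => H) θ := by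
  induction ns generalizing C with
  | nil =>
    rw [List.append_nil] at hC
    subst hC
    obtain ⟨P, w, φ, E', ρ, -, d, hd⟩ := complete_toNRE hg hk R ℓ hℓ σ σ' H H' v x hH ∅
    refine ⟨P, w, φ, E', ρ, d, fun θ hθ hρ => ?_⟩
    obtain ⟨h₁, h₂, -⟩ := hd θ (fun i => hθ i (by simp)) hρ
    exact ⟨h₁, h₂⟩
  | cons n ns ih =>
    obtain ⟨P, w, φ, E', ρ, d, hd⟩ := ih (C ++ [n]) (by simp [hC])
    have hlen := d.length_eq (natExtant_length _)
    obtain ⟨E, t, rfl⟩ : ∃ E t, E' = E ++ [t] := by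
      have hE : E' ≠ [] := by
        rintro rfl
        simp at hlen
      exact ⟨_, _, (List.dropLast_append_getLast hE).symm⟩
    obtain ⟨p, hp⟩ := Infinite.exists_notMem_finset P
    have hl : C.length < r := by
      have := congrArg List.length hC
      simp at this
      omega
    have hget : ∀ (i : Fin r) (hi : (i : ℕ) < C.length), C[(i : ℕ)] = g i := fun i hi => by
      have h := ofFn_getElem?_coe g i
      rw [hC, List.getElem?_append_left hi, List.getElem?_eq_getElem hi] at h
      exact Option.some.inj h
    have hn : g ⟨C.length, hl⟩ = n := by
      have h := ofFn_getElem?_coe g ⟨C.length, hl⟩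
      simpa [hC] using h.symm
    have hnd : (C ++ n :: ns).Nodup := hC ▸ List.nodup_ofFn.2 hg
    have hnC : n ∉ C := fun h => (List.nodup_append.1 hnd).2.2 n h n (List.mem_cons_self ..) rfl
    -- Each binder is opened with its own name, so no renaming occurs.
    have d' : Derives (C ++ [n]) ((bindAll ns (R.toNRE g k)).perm (Equiv.swap n n))
        ((natExtant C).snoc (.name n) ++ [⟨[.name n], .name n⟩]) P w φ (E ++ [t]) := by
      rw [Equiv.swap_self, ← natExtant_append_singleton]
      exact (perm_one (bindAll ns (R.toNRE g k))).symm ▸ d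
    refine ⟨_, _, _, _, Function.update ρ p (σ ⟨C.length, hl⟩), .bind_eq p hnC hp d',
      fun θ hθ hρ => ?_⟩
    have hθp : θ (.hole p) = σ ⟨C.length, hl⟩ := by
      rw [hρ p (Finset.mem_insert_self p P), Function.update_self]
    have hθC : ∀ i : Fin r, (i : ℕ) < C.length → g i ≠ n := fun i hi h =>
      hnC (h ▸ hget i hi ▸ List.getElem_mem hi)
    obtain ⟨hw, hφ⟩ := hd (θ ∘ tr (.name n) (.hole p)) (fun i hi => by
        rw [List.length_append, List.length_singleton, Nat.lt_succ_iff_lt_or_eq] at hi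
        rcases hi with hi | hi
        · simpa [tr, Equiv.swap_apply_def, hθC i hi] using hθ i hi
        · obtain rfl : i = ⟨C.length, hl⟩ := Fin.ext hi
          simpa [tr, hn] using hθp)
      (fun q hq => by
        have hqp : q ≠ p := fun h => hp (h ▸ hq)
        have := hρ q (Finset.mem_insert_of_mem hq)
        rw [Function.update_of_ne hqp] at this
        simpa [tr, Equiv.swap_apply_def, hqp] using this)
    refine ⟨by rw [map_renWord, hw], fun c hc => ?_⟩
    rcases List.mem_cons.1 hc with rfl | hc
    · intro y hy
      obtain ⟨m, hm, rfl⟩ := List.mem_map.1 hy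
      obtain ⟨i, hi, rfl⟩ := List.mem_iff_getElem.1 hm
      have h := hget ⟨i, hi.trans hl⟩ hi
      rw [hθp, h, hθ ⟨i, hi.trans hl⟩ hi]
      -- Local freshness of the prefix placeholders is injectivity of the initial registers.
      exact fun e => absurd (Fin.val_eq_of_eq (hσ e)) hi.ne'
    · obtain ⟨c', hc', rfl⟩ := List.mem_map.1 hc
      exact Cond.satIn_ren.2 (hφ c' hc')

theorem exists_exec_of_mem_lang_bindAll {g : Fin r → N} {k : N} (hg : g.Injective)
    (hk : ∀ i, g i ≠ k) {R : RegularExpression (FRALabel S r)} {v : List (S ⊕ N)}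
    (hv : v ∈ (bindAll (List.ofFn g) (R.toNRE g k)).lang) :
    ∃ ℓ ∈ R.matches', ∃ σ σ' H', Exec ℓ σ ∅ v σ' H' := by
  obtain ⟨P, w, φ, E, ρ, d, hφ, rfl⟩ := hv
  exact exists_exec_of_derives_bindAll _ hg hk rfl d _
    fun c hc => (Cond.sat_iff_satIn_empty ρ c).1 (hφ c hc)

theorem mem_lang_bindAll_of_exec [Infinite N] {g : Fin r → N} {k : N} (hg : g.Injective)
    (hk : ∀ i, g i ≠ k) {R : RegularExpression (FRALabel S r)} {ℓ : List (FRALabel S r)}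
    (hℓ : ℓ ∈ R.matches') {σ σ' : Fin r → N} {H H' : Set N} {v : List (S ⊕ N)}
    (hσ : σ.Injective) (hH : Set.range σ ⊆ H) (x : Exec ℓ σ H v σ' H') :
    v ∈ (bindAll (List.ofFn g) (R.toNRE g k)).lang := by
  obtain ⟨P, w, φ, E, ρ, d, h⟩ := derives_bindAll_of_exec hg hk hℓ hσ hH x _ [] rfl
  obtain ⟨hw, hφ⟩ := h (Atom.val ρ) (fun i hi => absurd hi (Nat.not_lt_zero _)) fun _ _ => rfl
  exact ⟨P, w, φ, E, ρ, d, fun c hc => (Cond.sat_iff_satIn_empty ρ c).2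
    ((hφ c hc).anti fun _ => Set.empty_subset H), hw.symm⟩

end NRE

end Prefixed

/-! ### Runs of automata versus executions of label words. -/

section Automata

variable {S N Q : Type*}

instance FRALabel.finite [Finite S] (r : ℕ) : Finite (FRALabel S r) := by
  let f : FRALabel S r → S ⊕ Fin r ⊕ Fin r ⊕ Fin r
    | .letter s => .inl s
    | .known i => .inr (.inl i)
    | .locFresh i => .inr (.inr (.inl i))
    | .globFresh i => .inr (.inr (.inr i))
  refine Finite.of_injective f fun a b h => ?_
  cases a <;> cases b <;> simp_all [f]

theorem LabelledPath.univ_nil_iff {α V : Type*} {step : V → α → V → Prop} {p q : V} :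
    LabelledPath step Set.univ p [] q ↔ p = q :=
  ⟨fun h => by cases h; rfl, fun h => h ▸ .nil p⟩

theorem LabelledPath.univ_cons_iff {α V : Type*} {step : V → α → V → Prop} {p q : V} {a : α}
    {w : List α} :
    LabelledPath step Set.univ p (a :: w) q ↔
      ∃ t, step p a t ∧ LabelledPath step Set.univ t w q := by
  constructor
  · intro h
    cases h with
    | single h => exact ⟨q, h, .nil q⟩
    | cons h _ hw => exact ⟨_, h, hw⟩
  · rintro ⟨t, h, hw⟩
    exact .cons h (Set.mem_univ t) hw

namespace FRA

/-- The transitions of `A` on its states together with the set of the registers that have been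
written to; only such registers are read. -/
def Step (A : FRA S N Q) (p : Q × Set (Fin A.regs)) (a : FRALabel S A.regs)
    (p' : Q × Set (Fin A.regs)) : Prop :=
  A.trans p.1 a p'.1 ∧
    match a with
    | .letter _ => p'.2 = p.2
    | .known i => i ∈ p.2 ∧ p'.2 = p.2
    | .locFresh i => p'.2 = insert i p.2
    | .globFresh i => p'.2 = insert i p.2

/-- The label words of the paths from `p` to a final state. -/
def AcceptsLabels (A : FRA S N Q) (p : Q × Set (Fin A.regs)) (ℓ : List (FRALabel S A.regs)) :
    Prop :=
  ∃ q' ∈ {q' : Q × Set (Fin A.regs) | q'.1 ∈ A.final}, LabelledPath A.Step Set.univ p ℓ q'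

theorem acceptsLabels_nil {A : FRA S N Q} {p : Q × Set (Fin A.regs)} :
    A.AcceptsLabels p [] ↔ p.1 ∈ A.final := by
  simp [AcceptsLabels, LabelledPath.univ_nil_iff]

theorem acceptsLabels_cons {A : FRA S N Q} {p : Q × Set (Fin A.regs)} {a : FRALabel S A.regs}
    {ℓ : List (FRALabel S A.regs)} :
    A.AcceptsLabels p (a :: ℓ) ↔ ∃ p', A.Step p a p' ∧ A.AcceptsLabels p' ℓ := by
  simp only [AcceptsLabels, LabelledPath.univ_cons_iff]
  constructor
  · rintro ⟨q', hq', t, h, hw⟩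
    exact ⟨t, h, q', hq', hw⟩
  · rintro ⟨t, h, q', hq', hw⟩
    exact ⟨q', hq', t, h, hw⟩

theorem exists_regularExpression [Finite S] [Finite Q] (A : FRA S N Q) :
    ∃ R : RegularExpression (FRALabel S A.regs), R.LettersIn {a | ∃ p q, A.Step p a q} ∧
      ∀ ℓ, ℓ ∈ R.matches' ↔ A.AcceptsLabels (A.init, ∅) ℓ := by
  classical
  have := Fintype.ofFinite (Q × Set (Fin A.regs))
  obtain ⟨R, hR, h⟩ := RegularExpression.exists_matches'_eq_biUnion {a | ∃ p q, A.Step p a q}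
    (Finset.univ.filter fun q' : Q × Set (Fin A.regs) => q'.1 ∈ A.final)
    (LabelledPath.language A.Step (Finset.univ : Finset (Q × Set (Fin A.regs))) (A.init, ∅))
    fun q' _ => LabelledPath.exists_matches'_eq_language A.Step Finset.univ _ q'
  refine ⟨R, hR, fun ℓ => ?_⟩
  rw [h, Finset.coe_univ]
  simp only [Finset.mem_filter, Finset.mem_univ, true_and]
  rfl

open Classical in
/-- The register assignment that agrees with `σ` on `D` and is empty elsewhere. -/
noncomputable def restrict {r : ℕ} (D : Set (Fin r)) (σ : Fin r → N) (i : Fin r) : Option N :=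
  if i ∈ D then some (σ i) else none

theorem restrict_eq_some {r : ℕ} {D : Set (Fin r)} {σ : Fin r → N} {i : Fin r} {a : N} :
    restrict D σ i = some a ↔ i ∈ D ∧ σ i = a := by
  by_cases h : i ∈ D <;> simp [restrict, h]

theorem restrict_insert {r : ℕ} (D : Set (Fin r)) (σ : Fin r → N) (i : Fin r) (a : N) :
    restrict (insert i D) (Function.update σ i a) =
      Function.update (restrict D σ) i (some a) := by
  funext j
  by_cases hj : j = i
  · subst hj; simp [restrict]
  · by_cases h : j ∈ D <;> simp [restrict, hj, h]

/-- Emptying the registers outside `D` is harmless: `FRA.Step` never reads them before they are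
written, and fewer contents only weaken local freshness. -/
theorem run_of_exec {A : FRA S N Q} {ℓ : List (FRALabel S A.regs)} {σ σ' : Fin A.regs → N}
    {H H' : Set N} {v : List (S ⊕ N)} (x : Exec ℓ σ H v σ' H') {q : Q} {D : Set (Fin A.regs)}
    (h : A.AcceptsLabels (q, D) ℓ) : A.Run q (restrict D σ) H v := by
  induction x generalizing q D with
  | nil => exact .nil (acceptsLabels_nil.1 h)
  | letter s _ ih =>
    obtain ⟨⟨q', D'⟩, ⟨ht, hD⟩, h'⟩ := acceptsLabels_cons.1 h
    obtain rfl : D' = D := hD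
    exact .letter ht (ih h')
  | known i _ ih =>
    obtain ⟨⟨q', D'⟩, ⟨ht, hi, hD⟩, h'⟩ := acceptsLabels_cons.1 h
    obtain rfl : D' = D := hD
    exact .known ht (restrict_eq_some.2 ⟨hi, rfl⟩) (ih h')
  | locFresh i ha _ ih =>
    obtain ⟨⟨q', D'⟩, ⟨ht, hD⟩, h'⟩ := acceptsLabels_cons.1 h
    obtain rfl : D' = insert i D := hD
    refine .locFresh ht (fun j hj => ha j (restrict_eq_some.1 hj).2) ?_
    rw [← restrict_insert]
    exact ih h'
  | globFresh i ha haH _ ih =>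
    obtain ⟨⟨q', D'⟩, ⟨ht, hD⟩, h'⟩ := acceptsLabels_cons.1 h
    obtain rfl : D' = insert i D := hD
    refine .globFresh ht haH ?_
    rw [← restrict_insert]
    exact ih h'

/-- Registers outside `D` hold names of `G`, which never occur in `v`. So no name read can clash
with them, and adding `G` to the history costs nothing. -/
theorem exists_exec_of_run {A : FRA S N Q} {q : Q} {τ : Fin A.regs → Option N} {H : Set N}
    {v : List (S ⊕ N)} (h : A.Run q τ H v) {D : Set (Fin A.regs)} {σ : Fin A.regs → N} {G : Set N}
    (hτ : τ = restrict D σ) (hH : ∀ i ∈ D, σ i ∈ H) (hG : ∀ i ∉ D, σ i ∈ G)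
    (hv : ∀ a ∈ G, .inr a ∉ v) :
    ∃ ℓ σ' H', A.AcceptsLabels (q, D) ℓ ∧ Exec ℓ σ (H ∪ G) v σ' H' := by
  have key : ∀ {H : Set N} {D : Set (Fin A.regs)} {σ : Fin A.regs → N} (i : Fin A.regs) (a : N),
      (∀ i ∈ D, σ i ∈ H) → (∀ i ∉ D, σ i ∈ G) →
      (∀ j ∈ insert i D, Function.update σ i a j ∈ insert a H) ∧
        ∀ j ∉ insert i D, Function.update σ i a j ∈ G := by
    intro H D σ i a hH hG
    constructor
    · intro j hj
      by_cases hji : j = i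
      · subst hji; simp
      · rw [Function.update_of_ne hji]
        exact .inr (hH j (hj.resolve_left hji))
    · intro j hj
      rw [Set.mem_insert_iff, not_or] at hj
      rw [Function.update_of_ne hj.1]
      exact hG j hj.2
  induction h generalizing D σ with
  | nil hq => exact ⟨[], σ, _, acceptsLabels_nil.2 hq, .nil _ _⟩
  | @letter q q' _ _ s _ ht _ ih =>
    obtain ⟨ℓ, σ', H', hℓ, x⟩ := ih hτ hH hG fun a ha h => hv a ha (List.mem_cons_of_mem _ h)
    exact ⟨_, σ', H', acceptsLabels_cons.2 ⟨(q', D), ⟨ht, rfl⟩, hℓ⟩, .letter s x⟩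
  | @known q q' _ _ i a _ ht ha _ ih =>
    obtain ⟨ℓ, σ', H', hℓ, x⟩ := ih hτ hH hG fun a ha h => hv a ha (List.mem_cons_of_mem _ h)
    rw [hτ, restrict_eq_some] at ha
    obtain ⟨hi, rfl⟩ := ha
    exact ⟨_, σ', H', acceptsLabels_cons.2 ⟨(q', D), ⟨ht, hi, rfl⟩, hℓ⟩, .known i x⟩
  | @locFresh q q' _ H i a _ ht ha _ ih =>
    obtain ⟨k₁, k₂⟩ := key i a hH hG
    obtain ⟨ℓ, σ', H', hℓ, x⟩ := ih (by rw [hτ, restrict_insert]) k₁ k₂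
      fun a ha h => hv a ha (List.mem_cons_of_mem _ h)
    rw [Set.insert_union] at x
    refine ⟨_, σ', H', acceptsLabels_cons.2 ⟨(q', insert i D), ⟨ht, rfl⟩, hℓ⟩,
      .locFresh i (fun j hj => ?_) x⟩
    by_cases hjD : j ∈ D
    · exact ha j (hτ ▸ restrict_eq_some.2 ⟨hjD, hj⟩)
    · exact hv a (hj ▸ hG j hjD) (List.mem_cons_self ..)
  | @globFresh q q' _ H i a _ ht ha _ ih =>
    obtain ⟨k₁, k₂⟩ := key i a hH hG
    obtain ⟨ℓ, σ', H', hℓ, x⟩ := ih (by rw [hτ, restrict_insert]) k₁ k₂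
      fun a ha h => hv a ha (List.mem_cons_of_mem _ h)
    rw [Set.insert_union] at x
    have haG : a ∉ G := fun h => hv a h (List.mem_cons_self ..)
    refine ⟨_, σ', H', acceptsLabels_cons.2 ⟨(q', insert i D), ⟨ht, rfl⟩, hℓ⟩,
      -- `Exec` also asks that the name differ from all registers: contents of written registers lie
      -- in `H`, the others in `G`.
      .globFresh i (fun j hj => ?_) (fun h => h.elim ha haG) x⟩
    by_cases hjD : j ∈ D
    · exact ha (hj ▸ hH j hjD)
    · exact haG (hj ▸ hG j hjD)

theorem Run.map_perm {A : FRA S N Q} {q : Q} {σ : Fin A.regs → Option N} {H : Set N}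
    {v : List (S ⊕ N)} (h : A.Run q σ H v) (π : Equiv.Perm N) :
    A.Run q (fun i => (σ i).map π) (π '' H) (v.map (Sum.map id π)) := by
  have key : ∀ (σ : Fin A.regs → Option N) (i : Fin A.regs) (a : N),
      (fun j => (Function.update σ i (some a) j).map π) =
        Function.update (fun j => (σ j).map π) i (some (π a)) := by
    intro σ i a
    funext j
    by_cases hj : j = i
    · subst hj; simp
    · simp [Function.update_of_ne hj]
  induction h with
  | nil hq => exact .nil hq
  | letter ht _ ih => exact .letter ht ih
  | known ht ha _ ih => exact .known ht (by simp [ha]) ih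
  | locFresh ht ha _ ih =>
    rw [key, Set.image_insert_eq] at ih
    refine .locFresh ht (fun j hj => ?_) ih
    obtain ⟨b, hb, hba⟩ := Option.map_eq_some_iff.1 hj
    exact ha j (hb.trans (congrArg some (π.injective hba)))
  | globFresh ht ha _ ih =>
    rw [key, Set.image_insert_eq] at ih
    refine .globFresh ht ?_ ih
    rintro ⟨b, hb, hba⟩
    exact ha (π.injective hba ▸ hb)

/-- `τ` arises from `σ` by filling some empty registers with names in `F`. -/
def Fills {r : ℕ} (F : Set N) (σ τ : Fin r → Option N) : Prop :=
  ∀ i, τ i = σ i ∨ σ i = none ∧ ∃ a ∈ F, τ i = some a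

theorem Fills.update {r : ℕ} {F : Set N} {σ τ : Fin r → Option N} (h : Fills F σ τ) (i : Fin r)
    (a : N) : Fills F (Function.update σ i (some a)) (Function.update τ i (some a)) := fun j => by
  by_cases hj : j = i
  · subst hj; simp
  · simpa only [Function.update_of_ne hj] using h j

/-- Filling empty registers with names that do not occur in the word does not disturb a run. -/
theorem Run.fill {A : FRA S N Q} {q : Q} {σ τ : Fin A.regs → Option N} {H K F : Set N}
    {v : List (S ⊕ N)} (h : A.Run q σ H v) (hv : ∀ a ∈ F, .inr a ∉ v)
    (hτ : Fills F σ τ) (hK : K ⊆ H ∪ F) :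
    A.Run q τ K v := by
  induction h generalizing τ K with
  | nil hq => exact .nil hq
  | letter ht _ ih =>
    exact .letter ht (ih (fun a ha h => hv a ha (List.mem_cons_of_mem _ h)) hτ hK)
  | @known _ _ _ _ i _ _ ht ha _ ih =>
    refine .known ht ?_ (ih (fun a ha h => hv a ha (List.mem_cons_of_mem _ h)) hτ hK)
    rcases hτ i with h | h
    · exact h.trans ha
    · rw [h.1] at ha; cases ha
  | @locFresh _ _ _ _ i a _ ht ha _ ih =>
    refine .locFresh ht (fun j hj => ?_)
      (ih (fun a ha h => hv a ha (List.mem_cons_of_mem _ h)) (hτ.update i a) ?_)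
    · rcases hτ j with h | ⟨-, b, hb, h⟩
      · exact ha j (h ▸ hj)
      · obtain rfl : b = a := Option.some.inj (h.symm.trans hj)
        exact hv b hb (List.mem_cons_self ..)
    · rw [Set.insert_union]; exact Set.insert_subset_insert hK
  | @globFresh _ _ _ _ i a _ ht ha _ ih =>
    refine .globFresh ht (fun h => (hK h).elim ha fun h => hv a h (List.mem_cons_self ..))
      (ih (fun a ha h => hv a ha (List.mem_cons_of_mem _ h)) (hτ.update i a) ?_)
    rw [Set.insert_union]; exact Set.insert_subset_insert hK

/-- Emptying registers whose contents do not occur in the word does not disturb a run. -/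
theorem Run.empty {A : FRA S N Q} {q : Q} {σ τ : Fin A.regs → Option N} {H K F : Set N}
    {v : List (S ⊕ N)} (h : A.Run q τ K v) (hv : ∀ a ∈ F, .inr a ∉ v)
    (hτ : Fills F σ τ) (hH : H ⊆ K) :
    A.Run q σ H v := by
  induction h generalizing σ H with
  | nil hq => exact .nil hq
  | letter ht _ ih =>
    exact .letter ht (ih (fun a ha h => hv a ha (List.mem_cons_of_mem _ h)) hτ hH)
  | @known _ _ _ _ i a _ ht ha _ ih =>
    refine .known ht ?_ (ih (fun a ha h => hv a ha (List.mem_cons_of_mem _ h)) hτ hH)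
    rcases hτ i with h | ⟨-, b, hb, h⟩
    · exact h.symm.trans ha
    · obtain rfl : b = a := Option.some.inj (h.symm.trans ha)
      exact absurd (List.mem_cons_self ..) (hv b hb)
  | @locFresh _ _ _ _ i a _ ht ha _ ih =>
    refine .locFresh ht (fun j hj => ?_)
      (ih (fun a ha h => hv a ha (List.mem_cons_of_mem _ h)) (hτ.update i a)
        (Set.insert_subset_insert hH))
    rcases hτ j with h | ⟨h, -⟩
    · exact ha j (h.trans hj)
    · rw [h] at hj; cases hj
  | @globFresh _ _ _ _ i a _ ht ha _ ih =>
    exact .globFresh ht (fun h => ha (hH h))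
      (ih (fun a ha h => hv a ha (List.mem_cons_of_mem _ h)) (hτ.update i a)
        (Set.insert_subset_insert hH))

theorem finite_setOf_inr_mem (v : List (S ⊕ N)) : {a : N | .inr a ∈ v}.Finite :=
  (List.finite_toSet v).preimage Sum.inr_injective.injOn

/-- The finite set `F` embeds into the infinite complement of `G`, and this injection extends to a
permutation. -/
theorem exists_perm_image_disjoint [Infinite N] {F G : Set N} (hF : F.Finite) (hG : G.Finite) :
    ∃ π : Equiv.Perm N, ∀ a ∈ F, π a ∉ G := by
  have := hF.to_subtype
  have := hG.infinite_compl.to_subtype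
  obtain ⟨n, ⟨e⟩⟩ := Finite.exists_equiv_fin F
  obtain ⟨π, hπ⟩ := Equiv.Perm.exists_extending_pair (Subtype.val : F → N)
    (fun a => (Infinite.natEmbedding (Gᶜ : Set N) (e a)).1) Subtype.val_injective
    fun a b h => e.injective (Fin.val_injective
      ((Infinite.natEmbedding _).injective (Subtype.val_injective h)))
  exact ⟨π, fun a ha => hπ ⟨a, ha⟩ ▸ (Infinite.natEmbedding (Gᶜ : Set N) _).2⟩

/-- If the language of `A` is closed under permutations, then the contents of the initial registers
are immaterial. -/
theorem mem_lang_iff_run_empty [Infinite N] {A : FRA S N Q} (hA : PermClosed A.lang)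
    (v : List (S ⊕ N)) : v ∈ A.lang ↔ A.Run A.init (fun _ => none) ∅ v := by
  set F : Set N := {a | ∃ i, A.initReg i = some a}
  have hF : F.Finite := by
    refine (Set.finite_range A.initReg).preimage (Option.some_injective N).injOn |>.subset ?_
    rintro a ⟨i, hi⟩
    exact ⟨i, hi⟩
  -- After `π` the word avoids the initial contents, so registers can be emptied or filled; `π.symm`
  -- then restores the word.
  obtain ⟨π, hπ⟩ := exists_perm_image_disjoint (finite_setOf_inr_mem v) hF
  have hv : ∀ a ∈ F, .inr a ∉ v.map (Sum.map id π) := by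
    intro a ha h
    obtain ⟨x | b, hb, hba⟩ := List.mem_map.1 h
    · cases hba
    · obtain rfl : π b = a := Sum.inr.inj hba
      exact hπ b hb ha
  have hinit : Fills F (fun _ => none) A.initReg := by
    intro i
    cases h : A.initReg i with
    | none => exact .inl rfl
    | some a => exact .inr ⟨rfl, a, ⟨i, h⟩, rfl⟩
  have hback : (v.map (Sum.map id π)).map (Sum.map id π.symm) = v := by
    rw [List.map_map, Sum.map_comp_map]
    simp
  constructor
  · intro h
    have h' : A.Run A.init (fun _ => none) ∅ (v.map (Sum.map id π)) :=
      Run.empty (hA π v h) hv hinit (Set.empty_subset _)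
    have h'' := h'.map_perm π.symm
    rwa [hback, Set.image_empty] at h''
  · intro h
    have h' := h.map_perm π
    rw [Set.image_empty] at h'
    have h'' : v.map (Sum.map id π) ∈ A.lang :=
      h'.fill hv hinit (Set.empty_union F).symm.subset
    have := hA π.symm _ h''
    rwa [hback] at this

end FRA

end Automata

/-! ### Equality of the languages and the theorem. -/

section Main

variable {S N Q : Type*} [DecidableEq N]

theorem FRA.lang_bindAll_eq [Infinite N] {A : FRA S N Q} (hA : PermClosed A.lang)
    {g : Fin A.regs → N} {k : N} (hg : g.Injective) (hk : ∀ i, g i ≠ k)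
    {R : RegularExpression (FRALabel S A.regs)}
    (hR : ∀ ℓ, ℓ ∈ R.matches' ↔ A.AcceptsLabels (A.init, ∅) ℓ) :
    (NRE.bindAll (List.ofFn g) (R.toNRE g k)).lang = A.lang := by
  have hempty : ∀ σ : Fin A.regs → N, restrict ∅ σ = fun _ => none := fun σ => by
    funext i
    simp [restrict]
  ext v
  rw [mem_lang_iff_run_empty hA]
  constructor
  · intro hv
    obtain ⟨ℓ, hℓ, σ, σ', H', x⟩ := NRE.exists_exec_of_mem_lang_bindAll hg hk hv
    exact hempty σ ▸ run_of_exec x ((hR ℓ).1 hℓ)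
  · intro hv
    have := (finite_setOf_inr_mem v).infinite_compl.to_subtype
    -- The initial contents are distinct names foreign to `v`, as both the filling and the prefix
    -- conditions demand.
    let f := Infinite.natEmbedding ({a : N | .inr a ∈ v}ᶜ : Set N)
    obtain ⟨ℓ, σ', H', hℓ, x⟩ := exists_exec_of_run hv (D := ∅)
      (G := Set.range fun i : Fin A.regs => (f i : N))
      (σ := fun i => f i) (hempty _).symm (fun i hi => hi.elim) (fun i _ => ⟨i, rfl⟩)
      (by rintro _ ⟨i, rfl⟩; exact (f i).2)
    exact NRE.mem_lang_bindAll_of_exec hg hk ((hR ℓ).2 hℓ)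
      (fun i j h => Fin.val_injective (f.injective (Subtype.val_injective h)))
      Set.subset_union_right x

end Main

theorem mainTheorem4 {S N Q : Type*} [Finite S] [Countable N] [Infinite N] [DecidableEq N]
    [Finite Q] (A : FRA S N Q) (hA : PermClosed A.lang) :
    (∃ (h : ℕ) (e : NRE S N),
      e.IsClosedUpNRE ∧ e.IsPrefixedFirstDegree h ∧ e.lang = A.lang) ∧
    (A.IsRA → ∃ (h : ℕ) (e : NRE S N),
      e.IsClosedPNRE ∧ e.IsPrefixedFirstDegree h ∧ e.lang = A.lang) := by
  obtain ⟨R, hRT, hR⟩ := A.exists_regularExpression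
  let f := Infinite.natEmbedding N
  let g : Fin A.regs → N := fun i => f i
  have hg : g.Injective := f.injective.comp Fin.val_injective
  have hk : ∀ i, g i ≠ f A.regs := fun i h => i.2.ne (f.injective h)
  have hfd := R.firstDegree_toNRE g (f A.regs)
  have hclosed : (NRE.bindAll (List.ofFn g) (R.toNRE g (f A.regs))).IsClosedUpNRE :=
    NRE.scopedIn_bindAll _ (hfd.scopedIn fun n hn => .inr hn)
  have hnd : (List.ofFn g ++ [f A.regs]).Nodup := by
    refine List.Nodup.append (List.nodup_ofFn.2 hg) (List.nodup_singleton _) ?_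
    rw [List.disjoint_singleton]
    intro h
    obtain ⟨i, hi⟩ := (List.mem_ofFn' g _).1 h
    exact hk i hi
  have hpre : (NRE.bindAll (List.ofFn g) (R.toNRE g (f A.regs))).IsPrefixedFirstDegree A.regs :=
    ⟨List.ofFn g, f A.regs, _, List.length_ofFn, hnd, hfd, rfl⟩
  have hlang := FRA.lang_bindAll_eq hA hg hk hR
  refine ⟨⟨_, _, hclosed, hpre, hlang⟩, fun hRA => ⟨_, _, ⟨hclosed, ?_⟩, hpre, hlang⟩⟩
  -- An underlined name would come from a globally fresh label in `R`, hence from such a transition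
  -- of `A`.
  refine NRE.underlineFree_bindAll _ (RegularExpression.underlineFree_toNRE g _ ?_ R hRT)
  rintro i ⟨p, q, h⟩
  exact hRA _ _ _ h.1
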